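/- Let $M=2^n$ with $n=\log_2 M\ge 1$, and consider the complete binary tree whose leaves are $M$ processes, exactly one of which (the target) is anomalous, process $m$ being the target with prior probability $\pi_m$. Leaves are on level $0$, the root is on level $\log_2M$. Probing a node on level $l$ yields an independent observation with law $g_l=\mathrm{Ber}(1-\mu_l)$ if the subtree of the node contains the target and with law $f_l=\mathrm{Ber}(\mu_l)$ otherwise, where $$\mu_l=\tfrac12-\left(\tfrac12-\mu_0\right)(l+1)^{-\alpha},\qquad \alpha\in\{1,2,\dots\},\quad 0<\mu_0<\tfrac12 .$$ For a cost $c\in(0,1)$ per observation, the information-directed random walk (IRW) is the following search strategy. It starts at the root. At a node of level $l\ge1$ it takes $K_l$ samples from each of the two children and computes, for each child, the sum log-likelihood ratio $\sum_{i=1}^{K_l}\log\frac{g_{l-1}(y_i)}{f_{l-1}(y_i)}$; if both sums are negative, it moves to the parent (the parent of the root being the root), otherwise to the child with the larger sum (ties are broken by an arbitrary fixed rule). At a leaf it takes samples one by one and updates the sum log-likelihood ratio of the current visit (with $g_0,f_0$); when the sum becomes negative it moves to the parent, and when the sum exceeds $\log\frac{\log_2M}{c}$ it stops and declares this leaf to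 be the target. Let $\tau$ be the total number of samples, $\delta$ the declared leaf, and $$Q=\sum_m\pi_m\mathbb E[\tau\mid H_m],\qquad R=\sum_m\pi_m\Pr[\delta\ne m\mid H_m]+c\,Q ,$$ where $H_m$ is the hypothesis that $m$ is the target; $R$ is the Bayes risk and $Q$ the sample complexity. Let $p_l^{(g)}(k)=\Pr\big[\sum_{i\le k}\log\frac{g_{l-1}(Y_i)}{f_{l-1}(Y_i)}>\max\{\sum_{i\le k}\log\frac{g_{l-1}(Z_i)}{f_{l-1}(Z_i)},0\}\big]$ and $p_l^{(f)}(k)=\Pr\big[\sum_{i\le k}\log\frac{g_{l-1}(Z_i)}{f_{l-1}(Z_i)}<0\big]^2$, with $Y_i\sim g_{l-1}$ and $Z_i\sim f_{l-1}$ all independent. A sample size $k$ has confidence level $p$ on level $l$ if $p_l^{(g)}(k)>p$ and $p_l^{(f)}(k)>p$. For $p\in(\frac12,1)$ let $K_l^{\min}(p)$ be the least sample size of confidence level $p$ on level $l$, and for $\eta\in(\frac1{\sqrt2},1)$ let $K_l^{\rm ex}(\eta)=\left\lceil \frac{12(1-\mu_{l-1})\log\frac1{1-\eta}}{(1-2\mu_{l-1})^2}\right\rceil$.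 Then: 1. $K_l^{\min}(p)$ exists for all $l\ge1$ and $p\in(\frac12,1)$, and $K_l^{\rm ex}(\eta)$ has confidence level $\eta^2>\frac12$ on every level $l\ge1$, for all $\eta\in(\frac1{\sqrt2},1)$. 2. For all $p\in(\frac12,1)$, $\eta\in(\frac1{\sqrt2},1)$ and $A\in\mathbb N$ there are constants $B_1,B_2$, depending only on $\alpha,\mu_0,p,\eta,A$, such that for all $n\ge 1$ and $M=2^n$, all $c\in(0,1)$, all priors, all tie-breaking rules and all sample sizes $K_l$ $(1\le l\le\log_2M)$ that have confidence level $p$ and satisfy $K_l\le A\max\{K_l^{\min}(p),K_l^{\rm ex}(\eta)\}$ (in particular for $K_l=K_l^{\min}(p)$, and, if $p=\eta^2$, for $K_l=K_l^{\rm ex}(\eta)$), the Bayes risk of IRW satisfies $$R\le B_1\,c\,(\log_2M)^{2\alpha+1}+\frac{c\log\frac{\log_2M}{c}}{D(g_0\|f_0)}+B_2\,c ,$$ where $D$ is the Kullback–Leibler divergence. 3. For the same strategies and every fixed $c\in(0,1)$, the sample complexity is polylogarithmic in $M$: $Q\le C(\log_2M)^{2\alpha+1}$ with $C$ depending only on $c,\alpha,\mu_0,p,\eta,A$.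 -/

import Mathlib

open MeasureTheory ProbabilityTheory
open scoped ENNReal

noncomputable section

namespace TreeSearch

/-! ### The binary tree with `M = 2 ^ n` leaves -/

/-- A node of the complete binary tree of depth `n`: the sequence of left (`true`) / right (`false`)
turns on the path from the root, the most recent turn first.  The root is `[]`. -/
abbrev Node (n : ℕ) : Type := {v : List Bool // v.length ≤ n}

/-- The leaves, i.e. the `2 ^ n` processes. -/
abbrev Leaf (n : ℕ) : Type := List.Vector Bool n

variable {n : ℕ}

/-- The level of a node: leaves are on level `0`, the root is on level `n = log₂ M`. -/
def Node.level (v : Node n) : ℕ := n - v.1.length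

def Node.root : Node n := ⟨[], Nat.zero_le n⟩

/-- The parent of a node; the parent of the root is the root itself. -/
def Node.parent (v : Node n) : Node n :=
  ⟨v.1.tail, by have h := v.2; rw [List.length_tail]; omega⟩

/-- The left (`b = true`) or right (`b = false`) child of a node that is not a leaf. -/
def Node.child (v : Node n) (b : Bool) : Node n :=
  if h : v.1.length < n then ⟨b :: v.1, h⟩ else v

/-- Leaf `m` belongs to the subtree rooted at `v`. -/
def Node.Contains (v : Node n) (m : Leaf n) : Prop := v.1 <:+ m.toList

/-! ### Bernoulli observations -/

/-- Law of an observation of a level-`l` node that does not contain the target: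
Bernoulli with parameter `μ l`. -/
def absentLaw (μ : ℕ → unitInterval) (l : ℕ) : Measure Bool :=
  bernoulliMeasure true false (μ l)

/-- Law of an observation of a level-`l` node that contains the target:
Bernoulli with parameter `1 - μ l`. -/
def presentLaw (μ : ℕ → unitInterval) (l : ℕ) : Measure Bool :=
  bernoulliMeasure true false (unitInterval.symm (μ l))

/-- Log-likelihood ratio `log (g_l(y) / f_l(y))` of a level-`l` observation `y`. -/
def logLR (μ : ℕ → unitInterval) (l : ℕ) (y : Bool) : ℝ :=
  Real.log ((presentLaw μ l).real {y} / (absentLaw μ l).real {y})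

open scoped Classical in
/-- Law of an observation of node `v` when leaf `m` is the target. -/
def obsLaw (μ : ℕ → unitInterval) (m : Leaf n) (v : Node n) : Measure Bool :=
  if v.Contains m then presentLaw μ v.level else absentLaw μ v.level

/-- Probability space under the hypothesis that leaf `m` is the target: `ω t v` is the value that is
seen if node `v` is probed at time `t`; all these values are independent. -/
def hypMeasure (μ : ℕ → unitInterval) (m : Leaf n) : Measure (ℕ → Node n → Bool) :=
  Measure.infinitePi fun _ : ℕ => Measure.infinitePi fun v : Node n => obsLaw μ m v

/-! ### Search strategies and their risk -/

/-- An active search strategy: given the list of the observations so far (oldest first), either probe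
a node next (`Sum.inl`) or stop and declare a leaf to be the target (`Sum.inr`). -/
abbrev Strategy (n : ℕ) : Type := List Bool → Node n ⊕ Leaf n

namespace Strategy

/-- The observations made up to time `t`; nothing is added after stopping. -/
def history (Γ : Strategy n) (ω : ℕ → Node n → Bool) : ℕ → List Bool
  | 0 => []
  | t + 1 =>
    match Γ (Γ.history ω t) with
    | Sum.inl v => Γ.history ω t ++ [ω t v]
    | Sum.inr _ => Γ.history ω t

/-- The number of observations taken before stopping (`⊤` if the strategy never stops). -/
def stopTime (Γ : Strategy n) (ω : ℕ → Node n → Bool) : ℝ≥0∞ :=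
  ⨅ (t : ℕ) (_ : (Γ (Γ.history ω t)).isRight), (t : ℝ≥0∞)

/-- The strategy stops at some time and declares leaf `m`. -/
def Declares (Γ : Strategy n) (m : Leaf n) (ω : ℕ → Node n → Bool) : Prop :=
  ∃ t : ℕ, Γ (Γ.history ω t) = Sum.inr m

/-- Probability of detection error under the prior `π`
(a run that never stops counts as an error). -/
def errorProb (Γ : Strategy n) (μ : ℕ → unitInterval) (π : PMF (Leaf n)) : ℝ≥0∞ :=
  ∑ m, π m * hypMeasure μ m {ω | ¬ Γ.Declares m ω}

/-- Sample complexity: expected number of observations under the prior `π`. -/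
def sampleComplexity (Γ : Strategy n) (μ : ℕ → unitInterval) (π : PMF (Leaf n)) : ℝ≥0∞ :=
  ∑ m, π m * ∫⁻ ω, Γ.stopTime ω ∂(hypMeasure μ m)

/-- Bayes risk with cost `c` per observation and loss `1` for a wrong declaration. -/
def bayesRisk (Γ : Strategy n) (μ : ℕ → unitInterval) (π : PMF (Leaf n)) (c : ℝ) : ℝ≥0∞ :=
  Γ.errorProb μ π + ENNReal.ofReal c * Γ.sampleComplexity μ π

end Strategy

/-! ### The sample sizes of the local test -/

/-- `p_l^{(g)}`: probability that the fixed-size local test with `k` samples per child, on a level-`l`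
node that contains the target, moves the walk closer to the target. -/
def confPresent (μ : ℕ → unitInterval) (l k : ℕ) : ℝ :=
  ((Measure.pi fun _ : Fin k => presentLaw μ (l - 1)).prod
      (Measure.pi fun _ : Fin k => absentLaw μ (l - 1))).real
    {w | max (∑ i, logLR μ (l - 1) (w.2 i)) 0 < ∑ i, logLR μ (l - 1) (w.1 i)}

/-- `p_l^{(f)}`: the same for a level-`l` node that does not contain the target. -/
def confAbsent (μ : ℕ → unitInterval) (l k : ℕ) : ℝ :=
  ((Measure.pi fun _ : Fin k => absentLaw μ (l - 1)).real
    {z | ∑ i, logLR μ (l - 1) (z i) < 0}) ^ 2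

/-- With `k` samples per child, the local test on level `l` has confidence level `p`. -/
def MeetsConfidence (μ : ℕ → unitInterval) (p : ℝ) (l k : ℕ) : Prop :=
  p < confPresent μ l k ∧ p < confAbsent μ l k

/-- The least sample size with which the local test on level `l` has confidence level `p`. -/
def minSampleSize (μ : ℕ → unitInterval) (p : ℝ) (l : ℕ) : ℕ :=
  sInf {k | MeetsConfidence μ p l k}

/-- The closed-form sample size
`⌈12 (1 - μ_{l-1}) log (1 / (1 - η)) / (1 - 2 μ_{l-1})²⌉`. -/
def explicitSampleSize (μ : ℕ → unitInterval) (η : ℝ) (l : ℕ) : ℕ :=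
  ⌈12 * (1 - (μ (l - 1) : ℝ)) * Real.log (1 / (1 - η)) / (1 - 2 * (μ (l - 1) : ℝ)) ^ 2⌉₊

/-- `K` is a choice of sample sizes for the levels `1, …, n`: the local tests have confidence level `p`,
and the sizes are at most `A` times the larger of the least possible and the closed-form one. -/
def IsSampleRule (μ : ℕ → unitInterval) (p η : ℝ) (A n : ℕ) (K : ℕ → ℕ) : Prop :=
  ∀ l : ℕ, 1 ≤ l → l ≤ n →
    MeetsConfidence μ p l (K l) ∧
      K l ≤ A * max (minSampleSize μ p l) (explicitSampleSize μ η l)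

/-! ### The information-directed random walk (IRW) -/

/-- State of the walk: the current node; the number of samples taken during the current visit; and
the sum log-likelihood ratios accumulated during the current visit.  On an upper-level node `sumL` and
`sumR` belong to the left and right child; on a leaf only `sumL` is used, for the leaf itself. -/
structure IRWState (n : ℕ) where
  node : Node n
  count : ℕ
  sumL : ℝ
  sumR : ℝ

/-- The state at the beginning of a visit to `v`. -/
def IRWState.enter (v : Node n) : IRWState n := ⟨v, 0, 0, 0⟩

/-- The move after a local test at `v`: to the parent if both sums are negative, otherwise to the child
with the larger sum (to the child `tie v` if the two sums are equal). -/
def localTestMove (tie : Node n → Bool) (v : Node n) (sL sR : ℝ) : Node n :=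
  if sL < 0 ∧ sR < 0 then v.parent
  else if sR < sL then v.child true
  else if sL < sR then v.child false
  else v.child (tie v)

/-- The action of IRW: on a leaf, declare it if its sum exceeds `log (log₂ M / c)` and otherwise probe
it; on an upper-level node of level `l`, probe the left child `K l` times, then the right child `K l`
times. -/
def irwAct (K : ℕ → ℕ) (c : ℝ) (s : IRWState n) : Node n ⊕ Leaf n :=
  if h : s.node.1.length = n then
    if Real.log ((n : ℝ) / c) < s.sumL then Sum.inr ⟨s.node.1, h⟩ else Sum.inl s.node
  else if s.count < K s.node.level then Sum.inl (s.node.child true)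
  else Sum.inl (s.node.child false)

/-- The new state of IRW after the observation `y`. -/
def irwUpdate (μ : ℕ → unitInterval) (K : ℕ → ℕ) (tie : Node n → Bool) (s : IRWState n) (y : Bool) :
    IRWState n :=
  if s.node.1.length = n then
    if s.sumL + logLR μ 0 y < 0 then IRWState.enter s.node.parent
    else ⟨s.node, s.count + 1, s.sumL + logLR μ 0 y, 0⟩
  else if s.count < K s.node.level then
    ⟨s.node, s.count + 1, s.sumL + logLR μ (s.node.level - 1) y, s.sumR⟩
  else if s.count + 1 < 2 * K s.node.level then
    ⟨s.node, s.count + 1, s.sumL, s.sumR + logLR μ (s.node.level - 1) y⟩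
  else
    IRWState.enter
      (localTestMove tie s.node s.sumL (s.sumR + logLR μ (s.node.level - 1) y))

/-- The IRW strategy with sample sizes `K`, started at the root. -/
def irw (n : ℕ) (μ : ℕ → unitInterval) (K : ℕ → ℕ) (tie : Node n → Bool) (c : ℝ) : Strategy n :=
  fun obs => irwAct K c (obs.foldl (irwUpdate μ K tie) (IRWState.enter Node.root))

/-! ### Polynomial decay to noise -/

/-- `μ_l = 1/2 - (1/2 - μ₀) (l + 1)^{-α}`, as a point of `[0, 1]` (the projection is the identity here
for `0 ≤ μ₀ ≤ 1/2`). -/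
def polyNoise (α : ℕ) (μ₀ : ℝ) (l : ℕ) : unitInterval :=
  Set.projIcc 0 1 zero_le_one (1 / 2 - (1 / 2 - μ₀) * (((l : ℝ) + 1) ^ α)⁻¹)

end TreeSearch

end

open TreeSearch

noncomputable section

namespace TreeSearch

/-! ### Bernoulli laws and their log-likelihood ratios -/

/-! The proof exhibits a potential on the states of the walk that dominates the expected loss still
to come: each observation lowers it by at least `c` in conditional mean, and it is at least 1 when a
wrong leaf is declared. Summing over time, error probability plus `c` times the expected number of
samples is at most the initial potential (`Strategy.IsPotential.risk_le`).

At the start of a visit the potential is a price `β` times the tree distance to the target, plus a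
constant. A local test approaches the target with probability at least `p > 1/2` and otherwise loses
at most one step, so the distance term falls by at least `β (2p - 1)` in mean (`local_test_drift`).
This pays for the `2 K_l` samples once `β (2p - 1) ≥ 2 c K_l`. On a leaf the sum log-likelihood
ratio is a random walk with steps `± logOdds`, and two terms are combined (`IsPrice.target_step`,
`IsPrice.other_step`). A linear term, as in Wald's identity, loses exactly `c` per sample, the drift
being `± D(g_0‖f_0)`. A likelihood-ratio martingale pays, on the target, `β` for leaving by mistake
and, on any other leaf, the loss 1 for crossing the threshold; in the latter case its initial value
is only `c / n`.

Chernoff's bound with exponents `± 1/2` shows that `O((1 - 2 μ_{l-1})⁻²) = O(l ^ (2 α))` samples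
reach a fixed confidence level, so both reference sample sizes are of this order. Hence `β` of order
`c n ^ (2 α)` suffices. The root has distance `n`, which gives `c n ^ (2 α + 1)`; the linear term on
the target gives `c log (n / c) / D` and, for the overshoot, `O(c)`. -/

instance (μ : ℕ → unitInterval) (l : ℕ) : IsProbabilityMeasure (absentLaw μ l) := by
  unfold absentLaw; infer_instance

instance (μ : ℕ → unitInterval) (l : ℕ) : IsProbabilityMeasure (presentLaw μ l) := by
  unfold presentLaw; infer_instance

instance {n : ℕ} (μ : ℕ → unitInterval) (m : Leaf n) (v : Node n) :
    IsProbabilityMeasure (obsLaw μ m v) := by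
  unfold obsLaw; split_ifs <;> infer_instance

lemma absentLaw_singleton (μ : ℕ → unitInterval) (l : ℕ) (y : Bool) :
    absentLaw μ l {y} = ENNReal.ofReal (if y then (μ l : ℝ) else 1 - μ l) := by
  rw [← ofReal_measureReal]
  congr 1
  cases y <;> simp [absentLaw]

lemma presentLaw_singleton (μ : ℕ → unitInterval) (l : ℕ) (y : Bool) :
    presentLaw μ l {y} = ENNReal.ofReal (if y then 1 - (μ l : ℝ) else μ l) := by
  rw [← ofReal_measureReal]
  congr 1
  cases y <;> simp [presentLaw]

lemma lintegral_absentLaw (μ : ℕ → unitInterval) (l : ℕ) (F : Bool → ℝ≥0∞) :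
    ∫⁻ y, F y ∂absentLaw μ l =
      F true * ENNReal.ofReal (μ l) + F false * ENNReal.ofReal (1 - μ l) := by
  simp [lintegral_fintype, absentLaw_singleton]

lemma lintegral_presentLaw (μ : ℕ → unitInterval) (l : ℕ) (F : Bool → ℝ≥0∞) :
    ∫⁻ y, F y ∂presentLaw μ l =
      F true * ENNReal.ofReal (1 - μ l) + F false * ENNReal.ofReal (μ l) := by
  simp [lintegral_fintype, presentLaw_singleton]

/-- The log-likelihood ratio `log ((1 - μ_l) / μ_l)` of a positive observation on level `l`. -/
def logOdds (μ : ℕ → unitInterval) (l : ℕ) : ℝ := Real.log ((1 - μ l) / μ l)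

lemma logLR_true (μ : ℕ → unitInterval) (l : ℕ) : logLR μ l true = logOdds μ l := by
  simp only [logLR, logOdds, measureReal_def, absentLaw_singleton, presentLaw_singleton, if_true]
  rw [ENNReal.toReal_ofReal (unitInterval.nonneg _),
    ENNReal.toReal_ofReal (unitInterval.one_minus_nonneg _)]

lemma logLR_false (μ : ℕ → unitInterval) (l : ℕ) : logLR μ l false = -logOdds μ l := by
  simp only [logLR, logOdds, measureReal_def, absentLaw_singleton, presentLaw_singleton,
    Bool.false_eq_true, if_false]
  rw [ENNReal.toReal_ofReal (unitInterval.nonneg _),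
    ENNReal.toReal_ofReal (unitInterval.one_minus_nonneg _), ← Real.log_inv, inv_div]

/-- Nondegenerate noise that is better than a fair coin. -/
def Informative (μ : ℕ → unitInterval) (l : ℕ) : Prop := 0 < (μ l : ℝ) ∧ (μ l : ℝ) < 1 / 2

section Informative

variable {μ : ℕ → unitInterval} {l : ℕ}

lemma Informative.logOdds_pos (h : Informative μ l) : 0 < logOdds μ l := by
  apply Real.log_pos
  rw [lt_div_iff₀ h.1]
  linarith [h.2]

lemma Informative.exp_logOdds (h : Informative μ l) :
    Real.exp (logOdds μ l) = (1 - μ l) / μ l :=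
  Real.exp_log (div_pos (by linarith [h.2]) h.1)

lemma Informative.mul_exp_logOdds (h : Informative μ l) :
    (μ l : ℝ) * Real.exp (logOdds μ l) = 1 - μ l := by
  rw [h.exp_logOdds, mul_div_cancel₀ _ h.1.ne']

lemma Informative.mul_exp_neg_logOdds (h : Informative μ l) :
    (1 - μ l : ℝ) * Real.exp (-logOdds μ l) = μ l := by
  rw [← h.mul_exp_logOdds, mul_assoc, ← Real.exp_add]
  simp

/-- The density of the present law relative to the absent one is `exp (logLR)`, so the divergence is
the mean of `logLR` on the target: the drift that later appears in Wald's identity. -/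
lemma Informative.klDiv_toReal (h : Informative μ l) :
    (InformationTheory.klDiv (presentLaw μ l) (absentLaw μ l)).toReal =
      (1 - 2 * μ l) * logOdds μ l := by
  have h1 := h.1
  have h2 : 0 < 1 - (μ l : ℝ) := by linarith [h.2]
  have hd : presentLaw μ l =
      (absentLaw μ l).withDensity fun y => ENNReal.ofReal (Real.exp (logLR μ l y)) := by
    refine Measure.ext_of_singleton fun y => ?_
    rw [withDensity_apply _ (MeasurableSet.singleton y), lintegral_singleton,
      presentLaw_singleton, absentLaw_singleton, ← ENNReal.ofReal_mul (Real.exp_nonneg _)]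
    congr 1
    cases y
    · simp [logLR_false, mul_comm, h.mul_exp_neg_logOdds]
    · simp [logLR_true, mul_comm, h.mul_exp_logOdds]
  have hac : presentLaw μ l ≪ absentLaw μ l := by
    rw [hd]; exact withDensity_absolutelyContinuous _ _
  rw [InformationTheory.toReal_klDiv_of_measure_eq hac (by rw [measure_univ, measure_univ])]
  have hr : (presentLaw μ l).rnDeriv (absentLaw μ l) =ᵐ[absentLaw μ l]
      fun y => ENNReal.ofReal (Real.exp (logLR μ l y)) := by
    conv_lhs => rw [hd]
    exact Measure.rnDeriv_withDensity _ (Measurable.of_discrete)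
  have hl : llr (presentLaw μ l) (absentLaw μ l) =ᵐ[presentLaw μ l] logLR μ l := by
    filter_upwards [hac.ae_le hr] with y hy
    rw [llr, hy, ENNReal.toReal_ofReal (Real.exp_nonneg _), Real.log_exp]
  rw [integral_congr_ae hl, integral_fintype Integrable.of_finite]
  simp [measureReal_def, presentLaw_singleton, logLR_true, logLR_false,
    ENNReal.toReal_ofReal h1.le, ENNReal.toReal_ofReal h2.le]
  ring

/-! ### Sums of independent log-likelihood ratios -/

/-- Expectation of `F (x + f y₁ + ⋯ + f yₖ)` for independent `y₁, …, yₖ` with law `ν`. -/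
def sumExp (ν : Measure Bool) (f : Bool → ℝ) (k : ℕ) (F : ℝ → ℝ≥0∞) (x : ℝ) : ℝ≥0∞ :=
  ∫⁻ z : Fin k → Bool, F (x + ∑ i, f (z i)) ∂(Measure.pi fun _ => ν)

section sumExp

variable {ν : Measure Bool} [IsProbabilityMeasure ν] {f : Bool → ℝ} {F : ℝ → ℝ≥0∞}

lemma sumExp_zero (x : ℝ) : sumExp ν f 0 F x = F x := by
  simp [sumExp]

/-- Conditioning on the first observation. This is why the expected potential after a test is a
martingale while the samples come in one by one. -/
lemma sumExp_succ (k : ℕ) (x : ℝ) :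
    sumExp ν f (k + 1) F x = ∫⁻ y, sumExp ν f k F (x + f y) ∂ν := by
  have h := (measurePreserving_piFinSuccAbove (fun _ : Fin (k + 1) => ν) 0).symm
  rw [sumExp, ← h.lintegral_comp Measurable.of_discrete,
    lintegral_prod _ Measurable.of_discrete.aemeasurable]
  simp [sumExp, Fin.sum_univ_succ, MeasurableEquiv.piFinSuccAbove, add_assoc]

lemma sumExp_exp (t r : ℝ) (hr₀ : 0 ≤ r)
    (hr : ∫⁻ y, ENNReal.ofReal (Real.exp (t * f y)) ∂ν = ENNReal.ofReal r) (k : ℕ) (x : ℝ) :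
    sumExp ν f k (fun x => ENNReal.ofReal (Real.exp (t * x))) x =
      ENNReal.ofReal (r ^ k * Real.exp (t * x)) := by
  induction k generalizing x with
  | zero => simp [sumExp_zero]
  | succ k ih =>
    simp only [sumExp_succ, ih, mul_add, Real.exp_add, ← mul_assoc]
    simp only [ENNReal.ofReal_mul (mul_nonneg (pow_nonneg hr₀ k) (Real.exp_nonneg (t * x)))]
    rw [lintegral_const_mul _ Measurable.of_discrete, hr, ← ENNReal.ofReal_mul (by positivity)]
    congr 1
    ring

/-- Chernoff's bound: on the complement the exponential of `t` times the sum is at least 1, and its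
mean is `r ^ k`. The sign of `t` is left free so that one statement serves both tails. -/
lemma measureReal_neg_sum_ge (t r : ℝ) (hr₀ : 0 ≤ r)
    (hr : ∫⁻ y, ENNReal.ofReal (Real.exp (t * f y)) ∂ν = ENNReal.ofReal r) (k : ℕ) :
    1 - r ^ k ≤ (Measure.pi fun _ : Fin k => ν).real {z | t * ∑ i, f (z i) < 0} := by
  have hm : MeasurableSet {z : Fin k → Bool | t * ∑ i, f (z i) < 0} := MeasurableSet.of_discrete
  have h := probReal_compl_eq_one_sub (μ := Measure.pi fun _ : Fin k => ν) hm
  have hb : (Measure.pi fun _ : Fin k => ν) {z | t * ∑ i, f (z i) < 0}ᶜ ≤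
      ENNReal.ofReal (r ^ k) := by
    have he := sumExp_exp t r hr₀ hr k 0
    rw [mul_zero, Real.exp_zero, mul_one] at he
    rw [← he, sumExp, ← lintegral_indicator_one hm.compl]
    refine lintegral_mono fun z => ?_
    by_cases hz : z ∈ {z : Fin k → Bool | t * ∑ i, f (z i) < 0}ᶜ
    · rw [Set.indicator_of_mem hz, zero_add]
      simpa using hz
    · simp [Set.indicator_of_notMem hz]
  have hb' := ENNReal.toReal_le_of_le_ofReal (by positivity) hb
  rw [← measureReal_def] at hb'
  linarith

end sumExp

/-! ### Confidence levels of the local test -/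

/-- The Bhattacharyya coefficient `2 √(μ_l (1 - μ_l))` of the two observation laws. -/
def overlap (μ : ℕ → unitInterval) (l : ℕ) : ℝ := 2 * (μ l * Real.exp (logOdds μ l / 2))

lemma overlap_nonneg (μ : ℕ → unitInterval) (l : ℕ) : 0 ≤ overlap μ l :=
  mul_nonneg zero_le_two (mul_nonneg (unitInterval.nonneg _) (Real.exp_nonneg _))

lemma Informative.one_sub_mul_exp_half (h : Informative μ l) :
    (1 - μ l : ℝ) * Real.exp (-(logOdds μ l / 2)) = μ l * Real.exp (logOdds μ l / 2) := by
  rw [← h.mul_exp_logOdds, mul_assoc, ← Real.exp_add]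
  ring_nf

/-- The square of the coefficient is `4 μ (1 - μ) = 1 - (1 - 2 μ)²`, and `1 - x ≤ exp (-x)`. -/
lemma Informative.overlap_le (h : Informative μ l) :
    overlap μ l ≤ Real.exp (-((1 - 2 * μ l) ^ 2 / 2)) := by
  refine (pow_le_pow_iff_left₀ (overlap_nonneg _ _) (Real.exp_nonneg _) two_ne_zero).1 ?_
  have h1 : overlap μ l ^ 2 = 1 - (1 - 2 * μ l) ^ 2 := by
    have h2 : Real.exp (logOdds μ l / 2) ^ 2 = Real.exp (logOdds μ l) := by
      rw [← Real.exp_nat_mul]; congr 1; push_cast; ring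
    rw [overlap, mul_pow, mul_pow, h2, pow_two (μ l : ℝ), mul_assoc, h.mul_exp_logOdds]
    ring
  have h2 : ((2 : ℕ) : ℝ) * -((1 - 2 * (μ l : ℝ)) ^ 2 / 2) = -(1 - 2 * (μ l : ℝ)) ^ 2 := by
    push_cast; ring
  rw [h1, ← Real.exp_nat_mul, h2]
  linarith [Real.add_one_le_exp (-(1 - 2 * (μ l : ℝ)) ^ 2)]

lemma Informative.lintegral_absentLaw_exp (h : Informative μ l) :
    ∫⁻ y, ENNReal.ofReal (Real.exp (1 / 2 * logLR μ l y)) ∂absentLaw μ l =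
      ENNReal.ofReal (overlap μ l) := by
  have h2 : 0 < 1 - (μ l : ℝ) := by linarith [h.2]
  rw [lintegral_absentLaw, logLR_true, logLR_false, ← ENNReal.ofReal_mul (Real.exp_nonneg _),
    ← ENNReal.ofReal_mul (Real.exp_nonneg _),
    ← ENNReal.ofReal_add (mul_nonneg (Real.exp_nonneg _) h.1.le)
      (mul_nonneg (Real.exp_nonneg _) h2.le)]
  congr 1
  have := h.one_sub_mul_exp_half
  rw [show 1 / 2 * -logOdds μ l = -(logOdds μ l / 2) by ring,
    show 1 / 2 * logOdds μ l = logOdds μ l / 2 by ring, overlap]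
  linarith

lemma Informative.lintegral_presentLaw_exp (h : Informative μ l) :
    ∫⁻ y, ENNReal.ofReal (Real.exp (-1 / 2 * logLR μ l y)) ∂presentLaw μ l =
      ENNReal.ofReal (overlap μ l) := by
  have h2 : 0 < 1 - (μ l : ℝ) := by linarith [h.2]
  rw [lintegral_presentLaw, logLR_true, logLR_false, ← ENNReal.ofReal_mul (Real.exp_nonneg _),
    ← ENNReal.ofReal_mul (Real.exp_nonneg _),
    ← ENNReal.ofReal_add (mul_nonneg (Real.exp_nonneg _) h2.le)
      (mul_nonneg (Real.exp_nonneg _) h.1.le)]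
  congr 1
  have := h.one_sub_mul_exp_half
  rw [show -1 / 2 * -logOdds μ l = logOdds μ l / 2 by ring,
    show -1 / 2 * logOdds μ l = -(logOdds μ l / 2) by ring, overlap]
  linarith

/-- It is enough that the sum of the child with the target is positive and every other sum is
negative. Each such event has probability above `η`, and the two children are independent, whence `η
^ 2`. -/
lemma Informative.meetsConfidence (h : Informative μ (l - 1)) {η : ℝ} (hη : 0 < η) {k : ℕ}
    (hk : overlap μ (l - 1) ^ k < 1 - η) : MeetsConfidence μ (η ^ 2) l k := by
  have ha := measureReal_neg_sum_ge (1 / 2) _ (overlap_nonneg _ _) h.lintegral_absentLaw_exp k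
  have hp := measureReal_neg_sum_ge (-1 / 2) _ (overlap_nonneg _ _) h.lintegral_presentLaw_exp k
  have ha' : η < (Measure.pi fun _ : Fin k => absentLaw μ (l - 1)).real
      {z | ∑ i, logLR μ (l - 1) (z i) < 0} := by
    refine lt_of_lt_of_le (by linarith) (ha.trans_eq ?_)
    congr 1; ext z; constructor <;> intro hz <;> simp only [Set.mem_ofPred_eq] at hz ⊢ <;> linarith
  have hp' : η < (Measure.pi fun _ : Fin k => presentLaw μ (l - 1)).real
      {z | 0 < ∑ i, logLR μ (l - 1) (z i)} := by
    refine lt_of_lt_of_le (by linarith) (hp.trans_eq ?_)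
    congr 1; ext z; constructor <;> intro hz <;> simp only [Set.mem_ofPred_eq] at hz ⊢ <;> linarith
  refine ⟨?_, pow_lt_pow_left₀ ha' hη.le two_ne_zero⟩
  calc η ^ 2 = η * η := sq η
    _ < _ := mul_lt_mul'' hp' ha' hη.le hη.le
    _ = _ := (measureReal_prod_prod _ _).symm
    _ ≤ confPresent μ l k := measureReal_mono fun w hw => by
      simp only [Set.mem_prod, Set.mem_ofPred_eq] at hw ⊢
      exact max_lt (hw.2.trans hw.1) hw.1

lemma Informative.meetsConfidence_explicitSampleSize (h : Informative μ (l - 1)) {η : ℝ}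
    (hη : 0 < η) (hη' : η < 1) : MeetsConfidence μ (η ^ 2) l (explicitSampleSize μ η l) := by
  refine h.meetsConfidence hη ?_
  set k := explicitSampleSize μ η l with hk
  set q : ℝ := (μ (l - 1) : ℝ)
  have hq : 0 < (1 - 2 * q) ^ 2 := by have := h.2; nlinarith
  have hL : 0 < Real.log (1 / (1 - η)) :=
    Real.log_pos ((one_lt_div (by linarith)).2 (by linarith))
  have hle : 12 * (1 - q) * Real.log (1 / (1 - η)) ≤ k * (1 - 2 * q) ^ 2 :=
    (div_le_iff₀ hq).1 (Nat.le_ceil _)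
  calc overlap μ (l - 1) ^ k ≤ Real.exp (-((1 - 2 * q) ^ 2 / 2)) ^ k :=
        pow_le_pow_left₀ (overlap_nonneg _ _) h.overlap_le k
    _ = Real.exp (k * -((1 - 2 * q) ^ 2 / 2)) := (Real.exp_nat_mul _ _).symm
    _ < Real.exp (-Real.log (1 / (1 - η))) := by
      -- Since `q < 1/2`, the factor `12 * (1 - q)` exceeds 6; any factor above 2 would do.
      rw [Real.exp_lt_exp]
      have := h.2
      nlinarith
    _ = 1 - η := by
      rw [one_div, Real.log_inv, neg_neg, Real.exp_log (by linarith)]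

/-- The least sample size exists and is at most the closed-form one. -/
lemma Informative.minSampleSize_spec (h : Informative μ (l - 1)) {p : ℝ} (hp : 0 < p)
    (hp' : p < 1) :
    MeetsConfidence μ p l (minSampleSize μ p l) ∧
      minSampleSize μ p l ≤ explicitSampleSize μ (Real.sqrt p) l := by
  have hm := h.meetsConfidence_explicitSampleSize (Real.sqrt_pos.2 hp)
    ((Real.sqrt_lt' one_pos).2 (by linarith))
  rw [Real.sq_sqrt hp.le] at hm
  exact ⟨Nat.sInf_mem (s := {k | MeetsConfidence μ p l k}) ⟨_, hm⟩, Nat.sInf_le hm⟩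

end Informative

/-! ### Polynomial decay -/

lemma polyNoise_coe (α : ℕ) {μ₀ : ℝ} (hμ₀ : 0 < μ₀) (hμ₀' : μ₀ < 1 / 2) (l : ℕ) :
    (polyNoise α μ₀ l : ℝ) = 1 / 2 - (1 / 2 - μ₀) * (((l : ℝ) + 1) ^ α)⁻¹ := by
  have h1 : 0 < (((l : ℝ) + 1) ^ α)⁻¹ := by positivity
  have h2 : (((l : ℝ) + 1) ^ α)⁻¹ ≤ 1 :=
    inv_le_one_of_one_le₀ (one_le_pow₀ (by linarith [Nat.cast_nonneg (α := ℝ) l]))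
  rw [polyNoise, Set.projIcc_of_mem zero_le_one (by constructor <;> nlinarith)]

lemma informative_polyNoise (α : ℕ) {μ₀ : ℝ} (hμ₀ : 0 < μ₀) (hμ₀' : μ₀ < 1 / 2) (l : ℕ) :
    Informative (polyNoise α μ₀) l := by
  have h1 : 0 < (((l : ℝ) + 1) ^ α)⁻¹ := by positivity
  have h2 : (((l : ℝ) + 1) ^ α)⁻¹ ≤ 1 :=
    inv_le_one_of_one_le₀ (one_le_pow₀ (by linarith [Nat.cast_nonneg (α := ℝ) l]))
  constructor <;> rw [polyNoise_coe α hμ₀ hμ₀'] <;> nlinarith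

/-- The children of a level-`l` node are on level `l - 1`, so `1 - 2 μ_{l-1} = (1 - 2 μ₀) l ^ (-α)`.
The summand 1 in the factor absorbs the rounding up. -/
lemma explicitSampleSize_polyNoise_le (α : ℕ) {μ₀ : ℝ} (hμ₀ : 0 < μ₀) (hμ₀' : μ₀ < 1 / 2)
    {η : ℝ} (hη : 0 < η) (hη' : η < 1) {l : ℕ} (hl : 1 ≤ l) :
    (explicitSampleSize (polyNoise α μ₀) η l : ℝ) ≤
      (12 * Real.log (1 / (1 - η)) / (1 - 2 * μ₀) ^ 2 + 1) * (l : ℝ) ^ (2 * α) := by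
  have hL : 0 < Real.log (1 / (1 - η)) :=
    Real.log_pos ((one_lt_div (by linarith)).2 (by linarith))
  have hl' : (1 : ℝ) ≤ l := by exact_mod_cast hl
  have hq := polyNoise_coe α hμ₀ hμ₀' (l - 1)
  have hi := informative_polyNoise α hμ₀ hμ₀' (l - 1)
  rw [Nat.cast_sub hl, Nat.cast_one, sub_add_cancel] at hq
  have h12 : 1 - 2 * (polyNoise α μ₀ (l - 1) : ℝ) = (1 - 2 * μ₀) * ((l : ℝ) ^ α)⁻¹ := by
    rw [hq]; ring
  have h1 : 0 < 1 - 2 * μ₀ := by linarith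
  have hone : (1 : ℝ) ≤ (l : ℝ) ^ (2 * α) := one_le_pow₀ hl'
  have hb : 12 * (1 - (polyNoise α μ₀ (l - 1) : ℝ)) * Real.log (1 / (1 - η)) /
      (1 - 2 * (polyNoise α μ₀ (l - 1) : ℝ)) ^ 2 ≤
      12 * Real.log (1 / (1 - η)) / (1 - 2 * μ₀) ^ 2 * (l : ℝ) ^ (2 * α) := by
    rw [h12, mul_pow, inv_pow, ← pow_mul, mul_comm α 2, ← div_div, div_inv_eq_mul]
    have := hi.1
    gcongr
    nlinarith
  refine (Nat.ceil_lt_add_one ?_).le.trans ?_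
  · have := hi.2
    have : 0 ≤ 1 - (polyNoise α μ₀ (l - 1) : ℝ) := by linarith
    positivity
  · linarith

/-! ### Verification of a risk bound by a potential function -/

instance (n : ℕ) : Finite (Node n) := List.finite_length_le Bool n

instance {n : ℕ} (μ : ℕ → unitInterval) (m : Leaf n) : IsProbabilityMeasure (hypMeasure μ m) := by
  unfold hypMeasure; infer_instance

namespace Strategy

variable {n : ℕ} (Γ : Strategy n) (μ : ℕ → unitInterval) (m : Leaf n)

lemma history_congr {ω ω' : ℕ → Node n → Bool} {t : ℕ} (h : ∀ s < t, ω s = ω' s) :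
    Γ.history ω t = Γ.history ω' t := by
  induction t with
  | zero => rfl
  | succ t ih =>
    simp only [history, ih fun s hs => h s (hs.trans (Nat.lt_succ_self t)),
      h t (Nat.lt_succ_self t)]

/-- The history as a function of the observations that are available before time `t`. -/
def historyOf (t : ℕ) (x : Finset.range t → Node n → Bool) : List Bool :=
  Γ.history (fun s => if h : s ∈ Finset.range t then x ⟨s, h⟩ else fun _ => false) t

lemma historyOf_restrict (t : ℕ) (ω : ℕ → Node n → Bool) :
    Γ.historyOf t (fun s => ω s) = Γ.history ω t :=
  Γ.history_congr fun s hs => by simp [hs]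

lemma measurable_comp_history (t : ℕ) (F : List Bool → ℝ≥0∞) :
    Measurable fun ω => F (Γ.history ω t) := by
  have h : Measurable fun x : Finset.range t → Node n → Bool => F (Γ.historyOf t x) :=
    Measurable.of_discrete
  have := h.comp (g := fun x => F (Γ.historyOf t x))
    (f := fun (ω : ℕ → Node n → Bool) (s : Finset.range t) => ω s) (by fun_prop)
  simpa only [Function.comp_def, historyOf_restrict] using this

/-- The history depends only on the coordinates before `t`, which are independent of coordinate `t`;
the fresh values can therefore be integrated out with the history frozen. -/
lemma lintegral_history_obs (t : ℕ) (φ : List Bool → (Node n → Bool) → ℝ≥0∞) :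
    ∫⁻ ω, φ (Γ.history ω t) (ω t) ∂hypMeasure μ m =
      ∫⁻ ω, ∫⁻ w, φ (Γ.history ω t) w ∂(Measure.infinitePi fun v => obsLaw μ m v)
        ∂hypMeasure μ m := by
  have hind : iIndepFun (fun (s : ℕ) (ω : ℕ → Node n → Bool) => ω s) (hypMeasure μ m) :=
    iIndepFun_infinitePi (X := fun _ ω => ω) (fun _ => measurable_id)
  have hdis : Disjoint (Finset.range t) {t} := by simp
  have hψ : Measurable fun x : ({t} : Finset ℕ) → Node n → Bool => x ⟨t, by simp⟩ := by fun_prop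
  have h2 := (hind.indepFun_finset _ _ hdis (fun s => by fun_prop)).comp
    measurable_id hψ
  simp only [Function.comp_def, id] at h2
  have hmeas : Measurable fun (ω : ℕ → Node n → Bool) (s : Finset.range t) => ω s := by fun_prop
  have hmap := (indepFun_iff_map_prod_eq_prod_map_map hmeas.aemeasurable
    (measurable_pi_apply t).aemeasurable).1 h2
  have hev : (hypMeasure μ m).map (fun ω => ω t) =
      Measure.infinitePi fun v => obsLaw μ m v :=
    Measure.infinitePi_map_eval _ t
  rw [hev] at hmap
  have hφ : Measurable fun q : (Finset.range t → Node n → Bool) × (Node n → Bool) =>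
      φ (Γ.historyOf t q.1) q.2 := Measurable.of_discrete
  have hl := lintegral_map hφ (hmeas.prodMk (measurable_pi_apply t)) (μ := hypMeasure μ m)
  simp only [historyOf_restrict] at hl
  rw [← hl, hmap, lintegral_prod _ hφ.aemeasurable, lintegral_map Measurable.of_discrete hmeas]
  simp only [historyOf_restrict]

/-- Indicator of the histories after which the strategy goes on. -/
def running (h : List Bool) : ℝ≥0∞ := if (Γ h).isLeft then 1 else 0

/-- `Φ` dominates the loss still to come when leaf `m` is the target and a probe costs `c`. -/
structure IsPotential (c : ℝ≥0∞) (Φ : List Bool → ℝ≥0∞) : Prop where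
  step : ∀ h v, Γ h = Sum.inl v → c + ∫⁻ y, Φ (h ++ [y]) ∂obsLaw μ m v ≤ Φ h
  wrong : ∀ h m', Γ h = Sum.inr m' → m' ≠ m → 1 ≤ Φ h

variable {Γ μ m} {c : ℝ≥0∞} {Φ : List Bool → ℝ≥0∞}

/-- The supermartingale inequality, integrated over the history. After stopping, the history is
frozen and nothing is charged. -/
lemma IsPotential.lintegral_succ (hΦ : Γ.IsPotential μ m c Φ) (t : ℕ) :
    c * ∫⁻ ω, Γ.running (Γ.history ω t) ∂hypMeasure μ m +
        ∫⁻ ω, Φ (Γ.history ω (t + 1)) ∂hypMeasure μ m ≤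
      ∫⁻ ω, Φ (Γ.history ω t) ∂hypMeasure μ m := by
  let φ : List Bool → (Node n → Bool) → ℝ≥0∞ := fun h w =>
    c * Γ.running h + Φ (match Γ h with | Sum.inl v => h ++ [w v] | Sum.inr _ => h)
  have h1 := Γ.lintegral_history_obs μ m t φ
  rw [← lintegral_const_mul _ (Γ.measurable_comp_history t _),
    ← lintegral_add_left (Measurable.const_mul (Γ.measurable_comp_history t _) _)]
  calc _ = ∫⁻ ω, φ (Γ.history ω t) (ω t) ∂hypMeasure μ m := by
        refine lintegral_congr fun ω => ?_
        cases h : Γ (Γ.history ω t) <;> simp only [φ, history, h]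
    _ ≤ _ := by
      rw [h1]
      refine lintegral_mono fun ω => ?_
      generalize Γ.history ω t = h
      simp only [φ, running]
      rcases hv : Γ h with v | m'
      · have h2 := (measurePreserving_eval_infinitePi (fun v => obsLaw μ m v) v).lintegral_comp
          (f := fun y => c + Φ (h ++ [y])) Measurable.of_discrete
        simp only [Sum.isLeft_inl, if_true, mul_one]
        rw [h2, lintegral_add_left measurable_const]
        rw [lintegral_const, measure_univ, mul_one]
        exact hΦ.step h v hv
      · simp

lemma IsPotential.sum_running_le (hΦ : Γ.IsPotential μ m c Φ) (t : ℕ) :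
    c * ∑ s ∈ Finset.range t, ∫⁻ ω, Γ.running (Γ.history ω s) ∂hypMeasure μ m +
        ∫⁻ ω, Φ (Γ.history ω t) ∂hypMeasure μ m ≤ Φ [] := by
  induction t with
  | zero => simp [history]
  | succ t ih =>
    refine le_trans ?_ ih
    rw [Finset.sum_range_succ, mul_add, add_assoc]
    gcongr
    exact hΦ.lintegral_succ t

variable (Γ) in
lemma stopTime_le_tsum_running (ω : ℕ → Node n → Bool) :
    Γ.stopTime ω ≤ ∑' t, Γ.running (Γ.history ω t) := by
  by_cases h : ∃ t, (Γ (Γ.history ω t)).isRight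
  · classical
    have hT := Nat.find_spec h
    calc Γ.stopTime ω ≤ (Nat.find h : ℝ≥0∞) := iInf₂_le (Nat.find h) hT
      _ = ∑ t ∈ Finset.range (Nat.find h), (1 : ℝ≥0∞) := by simp
      _ = ∑ t ∈ Finset.range (Nat.find h), Γ.running (Γ.history ω t) := by
        refine Finset.sum_congr rfl fun t ht => ?_
        have := Nat.find_min h (Finset.mem_range.1 ht)
        rw [Sum.not_isRight] at this
        simp [running, this]
      _ ≤ _ := ENNReal.sum_le_tsum _
  · push Not at h
    have : ∀ t, Γ.running (Γ.history ω t) = 1 := fun t => by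
      have := h t
      simp only [running]
      rw [if_pos]
      simpa using this
    simp only [this]
    rw [ENNReal.tsum_const_eq_top_of_ne_zero one_ne_zero]
    exact le_top

/-- A potential function bounds the expected loss. -/
theorem IsPotential.risk_le (hΦ : Γ.IsPotential μ m c Φ) (hc : c ≠ 0) (hc' : c ≠ ⊤) :
    hypMeasure μ m {ω | ¬ Γ.Declares m ω} + c * ∫⁻ ω, Γ.stopTime ω ∂hypMeasure μ m ≤ Φ [] := by
  rcases eq_or_ne (Φ []) ⊤ with htop | htop
  · rw [htop]; exact le_top
  set N : ℕ → ℝ≥0∞ := fun t => ∫⁻ ω, Γ.running (Γ.history ω t) ∂hypMeasure μ m with hN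
  have hsum : Filter.Tendsto (fun t => c * ∑ s ∈ Finset.range t, N s) Filter.atTop
      (nhds (c * ∑' s, N s)) :=
    ENNReal.Tendsto.const_mul ENNReal.summable.hasSum.tendsto_sum_nat (Or.inr hc')
  have hle : c * ∑' s, N s ≤ Φ [] :=
    le_of_tendsto' hsum fun t => le_self_add.trans (hΦ.sum_running_le t)
  have hfin : ∑' s, N s ≠ ⊤ := fun h => by
    rw [h, ENNReal.mul_top hc] at hle
    exact htop (top_le_iff.1 hle)
  -- At any time a run that never declares `m` either still goes on or has stopped at a wrong leaf.
  -- In both cases the integrand is at least 1, so Markov's inequality applies.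
  have herr : ∀ t, hypMeasure μ m {ω | ¬ Γ.Declares m ω} ≤
      N t + ∫⁻ ω, Φ (Γ.history ω t) ∂hypMeasure μ m := fun t => by
    rw [hN, ← lintegral_add_left (Γ.measurable_comp_history t _)]
    refine le_trans (measure_mono fun ω hω => ?_) (meas_ge_le_lintegral_div
      ((Γ.measurable_comp_history t Γ.running).add
        (Γ.measurable_comp_history t Φ)).aemeasurable one_ne_zero ENNReal.one_ne_top
        |>.trans_eq (div_one _))
    simp only [Set.mem_ofPred_eq, Pi.add_apply, running] at hω ⊢
    rcases hv : Γ (Γ.history ω t) with v | m'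
    · simp
    · refine le_add_left (hΦ.wrong _ m' hv ?_)
      rintro rfl
      exact hω ⟨t, hv⟩
  -- The series of the `N t` converges, so the probability of still running tends to 0 and drops out
  -- in the limit.
  have hlim : hypMeasure μ m {ω | ¬ Γ.Declares m ω} + c * ∑' s, N s ≤ 0 + Φ [] := by
    refine le_of_tendsto_of_tendsto' (tendsto_const_nhds.add hsum)
      ((ENNReal.tendsto_atTop_zero_of_tsum_ne_top hfin).add tendsto_const_nhds) fun t => ?_
    calc _ ≤ N t + ∫⁻ ω, Φ (Γ.history ω t) ∂hypMeasure μ m + c * ∑ s ∈ Finset.range t, N s := by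
          gcongr; exact herr t
      _ = N t + (c * ∑ s ∈ Finset.range t, N s + ∫⁻ ω, Φ (Γ.history ω t) ∂hypMeasure μ m) := by
          ring
      _ ≤ N t + Φ [] := by gcongr; exact hΦ.sum_running_le t
  rw [zero_add] at hlim
  refine le_trans ?_ hlim
  gcongr
  rw [hN, ← lintegral_tsum fun t => (Γ.measurable_comp_history t _).aemeasurable]
  exact lintegral_mono fun ω => Γ.stopTime_le_tsum_running ω

end Strategy

/-! ### Distances in the tree -/

section Tree

variable {n : ℕ}

open scoped Classical in
/-- Distance in the tree of depth `n` from a node, given by its turns, to the leaf `m`. -/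
def turnsDist (n : ℕ) (m : List Bool) : List Bool → ℕ
  | [] => n
  | b :: v => if b :: v <:+ m then n - (v.length + 1) else turnsDist n m v + 1

/-- Distance in the tree from a node to a leaf. -/
def Node.dist (v : Node n) (m : Leaf n) : ℕ := turnsDist n m.toList v.1

lemma Node.dist_of_contains {v : Node n} {m : Leaf n} (h : v.Contains m) :
    v.dist m = n - v.1.length := by
  obtain ⟨v, hv⟩ := v
  cases v with
  | nil => simp [Node.dist, turnsDist]
  | cons b v =>
    have h' : b :: v <:+ m.toList := h
    simp [Node.dist, turnsDist, h']

lemma Node.root_dist (m : Leaf n) : (Node.root : Node n).dist m = n := rfl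

lemma Node.parent_dist_of_not_contains {v : Node n} {m : Leaf n} (h : ¬ v.Contains m) :
    v.parent.dist m + 1 = v.dist m := by
  obtain ⟨v, hv⟩ := v
  cases v with
  | nil => exact absurd (List.nil_suffix) h
  | cons b v =>
    have h' : ¬ (b :: v <:+ m.toList) := h
    simp [Node.dist, turnsDist, Node.parent, h']

lemma Node.parent_dist_le (v : Node n) (m : Leaf n) : v.parent.dist m ≤ v.dist m + 1 := by
  by_cases h : v.Contains m
  · have h' : v.parent.Contains m := (List.tail_suffix _).trans h
    rw [Node.dist_of_contains h, Node.dist_of_contains h']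
    simp only [Node.parent, List.length_tail]
    omega
  · have := Node.parent_dist_of_not_contains h
    omega

lemma Node.child_val {v : Node n} (hv : v.1.length < n) (b : Bool) :
    (v.child b).1 = b :: v.1 := by
  simp [Node.child, hv]

lemma Node.child_level {v : Node n} (hv : v.1.length < n) (b : Bool) :
    (v.child b).level = v.level - 1 := by
  simp only [Node.level, Node.child_val hv, List.length_cons]
  omega

lemma Node.child_dist_le (v : Node n) (b : Bool) (m : Leaf n) :
    (v.child b).dist m ≤ v.dist m + 1 := by
  by_cases hv : v.1.length < n
  · by_cases h : (v.child b).Contains m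
    · rw [Node.dist_of_contains h, Node.child_val hv]
      have h' : v.Contains m := by
        rw [Node.Contains, Node.child_val hv] at h
        exact (List.suffix_cons _ _).trans h
      rw [Node.dist_of_contains h']
      simp only [List.length_cons]
      omega
    · have := Node.parent_dist_of_not_contains h
      have h' : (v.child b).parent = v := by
        apply Subtype.ext
        simp [Node.parent, Node.child_val hv]
      rw [h'] at this
      exact this.ge
  · simp [Node.child, hv]

/-- Exactly one child of an inner node that contains the target contains it. -/
lemma Node.exists_child_contains {v : Node n} {m : Leaf n} (hv : v.1.length < n)
    (h : v.Contains m) :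
    ∃ b, (v.child b).Contains m ∧ ¬ (v.child (!b)).Contains m ∧
      (v.child b).dist m + 1 = v.dist m := by
  obtain ⟨u, hu⟩ := id h
  have hm : m.toList.length = n := m.2
  rcases List.eq_nil_or_concat u with rfl | ⟨u, b, rfl⟩
  · rw [List.nil_append] at hu
    rw [← hu] at hm
    omega
  · have hb : (v.child b).Contains m := by
      rw [Node.Contains, Node.child_val hv]
      exact ⟨u, by simpa using hu⟩
    refine ⟨b, hb, fun hb' => ?_, ?_⟩
    · rw [Node.Contains, Node.child_val hv] at hb hb'
      have := (List.suffix_of_suffix_length_le hb hb' (by simp)).eq_of_length (by simp)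
      cases b <;> simp at this
    · rw [Node.dist_of_contains hb, Node.dist_of_contains h, Node.child_val hv]
      simp only [List.length_cons]
      omega

lemma Node.dist_pos_of_length_lt {v : Node n} {m : Leaf n} (hv : v.1.length < n) :
    1 ≤ v.dist m := by
  by_cases h : v.Contains m
  · rw [Node.dist_of_contains h]; omega
  · have := Node.parent_dist_of_not_contains h
    omega

lemma Node.localTestMove_dist_le (tie : Node n → Bool) (v : Node n) (x y : ℝ) (m : Leaf n) :
    (localTestMove tie v x y).dist m ≤ v.dist m + 1 := by
  unfold localTestMove
  split_ifs <;> first | exact v.parent_dist_le m | exact v.child_dist_le _ m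

lemma obsLaw_of_contains (μ : ℕ → unitInterval) {m : Leaf n} {v : Node n} (h : v.Contains m) :
    obsLaw μ m v = presentLaw μ v.level := if_pos h

lemma obsLaw_of_not_contains (μ : ℕ → unitInterval) {m : Leaf n} {v : Node n}
    (h : ¬ v.Contains m) : obsLaw μ m v = absentLaw μ v.level := if_neg h

end Tree

/-! ### Drift of the walk on the upper levels -/

/-- The distance `d` falls by one on `E` and rises by at most one elsewhere, so its mean change is
at most `1 - 2p`; at price `β` per step this covers the cost `t`. -/
lemma lintegral_le_of_drift {Z : Type*} [MeasurableSpace Z] {P : Measure Z}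
    [IsProbabilityMeasure P] {X : Z → ℝ≥0∞} {E : Set Z} {p β γ t : ℝ} {d : ℕ} (hβ : 0 ≤ β)
    (hγ : 0 ≤ γ) (ht : 0 ≤ t) (hX : Measurable X) (hE : MeasurableSet E)
    (hpE : p ≤ P.real E)
    (hd : 1 ≤ d) (hup : ∀ z, X z ≤ ENNReal.ofReal (β * (d + 1) + γ))
    (hdown : ∀ z ∈ E, X z ≤ ENNReal.ofReal (β * (d - 1) + γ)) (htp : t + β ≤ 2 * β * p) :
    ENNReal.ofReal t + ∫⁻ z, X z ∂P ≤ ENNReal.ofReal (β * d + γ) := by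
  have hd' : (1 : ℝ) ≤ d := by exact_mod_cast hd
  -- The gain of `2 * β` on `E` is added on the left, which avoids subtraction in `ℝ≥0∞`.
  have hpt : ∀ z, X z + E.indicator (fun _ => ENNReal.ofReal (2 * β)) z ≤
      ENNReal.ofReal (β * (d + 1) + γ) := fun z => by
    by_cases hz : z ∈ E
    · rw [Set.indicator_of_mem hz]
      refine (add_le_add_left (hdown z hz) _).trans ?_
      rw [← ENNReal.ofReal_add (add_nonneg (mul_nonneg hβ (by linarith)) hγ) (by positivity)]
      exact ENNReal.ofReal_le_ofReal (by linarith)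
    · rw [Set.indicator_of_notMem hz, add_zero]
      exact hup z
  have hint := lintegral_mono (μ := P) hpt
  rw [lintegral_add_left hX, lintegral_indicator_const hE, lintegral_const, measure_univ,
    mul_one, ← ofReal_measureReal, ← ENNReal.ofReal_mul (by positivity)] at hint
  have h1 : ENNReal.ofReal t + ENNReal.ofReal β ≤ ENNReal.ofReal (2 * β * P.real E) := by
    rw [← ENNReal.ofReal_add ht hβ]
    exact ENNReal.ofReal_le_ofReal (htp.trans (by gcongr))
  have h2 : ENNReal.ofReal (β * (d + 1) + γ) =
      ENNReal.ofReal (β * d + γ) + ENNReal.ofReal β := by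
    rw [← ENNReal.ofReal_add (by positivity) hβ]; congr 1; ring
  rw [h2] at hint
  refine (ENNReal.add_le_add_iff_right (a := ENNReal.ofReal β) ENNReal.ofReal_ne_top).1 ?_
  refine le_trans ?_ hint
  rw [add_right_comm, add_comm]
  gcongr

lemma sumExp_sumExp (ν ν' : Measure Bool) [IsProbabilityMeasure ν] [IsProbabilityMeasure ν']
    (f : Bool → ℝ) (k : ℕ) (G : ℝ → ℝ → ℝ≥0∞) :
    sumExp ν f k (fun x => sumExp ν' f k (fun y => G x y) 0) 0 =
      ∫⁻ z, G (∑ i, f (z.1 i)) (∑ i, f (z.2 i))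
        ∂((Measure.pi fun _ : Fin k => ν).prod (Measure.pi fun _ : Fin k => ν')) := by
  rw [lintegral_prod _ Measurable.of_discrete.aemeasurable]
  simp [sumExp]

section Drift

variable {n : ℕ} {μ : ℕ → unitInterval} {p : ℝ} {k : ℕ} {m : Leaf n} {v : Node n}

/-- With probability at least `p` a local test moves the walk towards the target. -/
lemma exists_good_event (tie : Node n → Bool) (hv : v.1.length < n)
    (hk : MeetsConfidence μ p v.level k) :
    ∃ E : Set ((Fin k → Bool) × (Fin k → Bool)),
      p ≤ ((Measure.pi fun _ : Fin k => obsLaw μ m (v.child true)).prod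
        (Measure.pi fun _ : Fin k => obsLaw μ m (v.child false))).real E ∧
      ∀ z ∈ E, (localTestMove tie v (∑ i, logLR μ (v.level - 1) (z.1 i))
        (∑ i, logLR μ (v.level - 1) (z.2 i))).dist m + 1 = v.dist m := by
  by_cases h : v.Contains m
  · obtain ⟨b, hb, hb', hd⟩ := Node.exists_child_contains hv h
    cases b with
    | true =>
      rw [Bool.not_true] at hb'
      rw [obsLaw_of_contains μ hb, obsLaw_of_not_contains μ hb', Node.child_level hv,
        Node.child_level hv]
      refine ⟨_, hk.1.le, fun z hz => ?_⟩
      rw [Set.mem_ofPred_eq] at hz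
      obtain ⟨h1, h2⟩ := max_lt_iff.1 hz
      rw [localTestMove, if_neg (fun h => absurd h.1 h2.not_gt), if_pos h1, hd]
    | false =>
      rw [Bool.not_false] at hb'
      rw [obsLaw_of_contains μ hb, obsLaw_of_not_contains μ hb', Node.child_level hv,
        Node.child_level hv]
      -- In `confPresent` the child with the target comes first; here it is the right child, so the
      -- coordinates are swapped.
      refine ⟨Prod.swap ⁻¹' {w | max (∑ i, logLR μ (v.level - 1) (w.2 i)) 0 <
        ∑ i, logLR μ (v.level - 1) (w.1 i)}, ?_, fun z hz => ?_⟩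
      · refine hk.1.le.trans_eq ?_
        rw [confPresent, measureReal_def, measureReal_def, ← Measure.prod_swap,
          Measure.map_apply measurable_swap MeasurableSet.of_discrete]
      · rw [Set.mem_preimage, Set.mem_ofPred_eq] at hz
        obtain ⟨h1, h2⟩ := max_lt_iff.1 hz
        simp only [Prod.fst_swap, Prod.snd_swap] at h1 h2
        rw [localTestMove, if_neg (fun h => absurd h.2 h2.not_gt), if_neg h1.not_gt, if_pos h1, hd]
  · have hc : ∀ b, ¬ (v.child b).Contains m := fun b hb => by
      rw [Node.Contains, Node.child_val hv] at hb
      exact h ((List.suffix_cons _ _).trans hb)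
    rw [obsLaw_of_not_contains μ (hc _), obsLaw_of_not_contains μ (hc _), Node.child_level hv,
      Node.child_level hv]
    refine ⟨{z | ∑ i, logLR μ (v.level - 1) (z i) < 0} ×ˢ
      {z | ∑ i, logLR μ (v.level - 1) (z i) < 0}, ?_, fun z hz => ?_⟩
    · rw [measureReal_prod_prod, ← sq]
      exact hk.2.le
    · rw [localTestMove, if_pos ⟨hz.1, hz.2⟩, Node.parent_dist_of_not_contains h]

lemma local_test_drift (tie : Node n → Bool) (hv : v.1.length < n)
    (hk : MeetsConfidence μ p v.level k) {β γ t : ℝ} (hβ : 0 ≤ β) (hγ : 0 ≤ γ) (ht : 0 ≤ t)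
    (htp : t + β ≤ 2 * β * p) :
    ENNReal.ofReal t +
      sumExp (obsLaw μ m (v.child true)) (logLR μ (v.level - 1)) k
        (fun x => sumExp (obsLaw μ m (v.child false)) (logLR μ (v.level - 1)) k
          (fun y => ENNReal.ofReal (β * (localTestMove tie v x y).dist m + γ)) 0) 0 ≤
      ENNReal.ofReal (β * v.dist m + γ) := by
  obtain ⟨E, hE, hE'⟩ := exists_good_event (m := m) tie hv hk
  rw [sumExp_sumExp]
  refine lintegral_le_of_drift hβ hγ ht Measurable.of_discrete MeasurableSet.of_discrete hE
    (Node.dist_pos_of_length_lt hv) (fun z => ?_) (fun z hz => ?_) htp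
  · gcongr
    exact_mod_cast Node.localTestMove_dist_le tie v _ _ m
  · gcongr
    rw [← hE' z hz]
    simp

end Drift

/-! ### The potential of the walk -/

section Potential

variable {n : ℕ}

/-- Potential of the target leaf when the sum log-likelihood ratio of the current visit is `x`; the
parameter `β` is the price of one step away from the target. -/
def targetPotential (μ : ℕ → unitInterval) (n : ℕ) (c β x : ℝ) : ℝ :=
  c * (Real.log (n / c) + logOdds μ 0 - x) / ((1 - 2 * μ 0) * logOdds μ 0) +
    β / (Real.exp (logOdds μ 0) - 1) * Real.exp (-x)

/-- Excess potential of another leaf over its parent when the sum log-likelihood ratio of the current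
visit is `x`. -/
def otherPotential (μ : ℕ → unitInterval) (n : ℕ) (c x : ℝ) : ℝ :=
  c * (x + logOdds μ 0) / ((1 - 2 * μ 0) * logOdds μ 0) + Real.exp (x - Real.log (n / c))

/-- Potential at the beginning of a visit. -/
def entryPotential (μ : ℕ → unitInterval) (c β : ℝ) (m : Leaf n) (v : Node n) : ℝ≥0∞ :=
  ENNReal.ofReal (β * v.dist m + targetPotential μ n c β 0)

open scoped Classical in
/-- Potential during a visit to a leaf. -/
def leafPotential (μ : ℕ → unitInterval) (c β : ℝ) (m : Leaf n) (s : IRWState n) : ℝ≥0∞ :=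
  if s.node.Contains m then ENNReal.ofReal (targetPotential μ n c β s.sumL)
  else entryPotential μ c β m s.node.parent + ENNReal.ofReal (otherPotential μ n c s.sumL)

/-- Potential during a local test: the cost of the remaining samples and the expected potential after
the move. -/
def testPotential (μ : ℕ → unitInterval) (K : ℕ → ℕ) (tie : Node n → Bool) (c β : ℝ) (m : Leaf n)
    (s : IRWState n) : ℝ≥0∞ :=
  ENNReal.ofReal c * ((2 * K s.node.level - s.count : ℕ) : ℝ≥0∞) +
    if s.count < K s.node.level then
      sumExp (obsLaw μ m (s.node.child true)) (logLR μ (s.node.level - 1))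
        (K s.node.level - s.count)
        (fun x => sumExp (obsLaw μ m (s.node.child false)) (logLR μ (s.node.level - 1))
          (K s.node.level)
          (fun y => entryPotential μ c β m (localTestMove tie s.node x y)) s.sumR) s.sumL
    else
      sumExp (obsLaw μ m (s.node.child false)) (logLR μ (s.node.level - 1))
        (2 * K s.node.level - s.count)
        (fun y => entryPotential μ c β m (localTestMove tie s.node s.sumL y)) s.sumR

/-- Potential of a state of the walk. -/
def statePotential (μ : ℕ → unitInterval) (K : ℕ → ℕ) (tie : Node n → Bool) (c β : ℝ) (m : Leaf n)
    (s : IRWState n) : ℝ≥0∞ :=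
  if s.node.1.length = n then leafPotential μ c β m s else testPotential μ K tie c β m s

/-- The states that the walk can reach. -/
structure IRWState.Reachable (μ : ℕ → unitInterval) (K : ℕ → ℕ) (s : IRWState n) : Prop where
  leaf : s.node.1.length = n → ∃ j : ℕ, s.sumL = j * logOdds μ 0
  test : s.node.1.length ≠ n → s.count < 2 * K s.node.level

variable {μ : ℕ → unitInterval} {K : ℕ → ℕ} {tie : Node n → Bool} {c β p : ℝ} {m : Leaf n}
  {s : IRWState n}

lemma reachable_enter (hK : ∀ l, 1 ≤ l → l ≤ n → 0 < K l) (v : Node n) :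
    (IRWState.enter v).Reachable μ K where
  leaf _ := ⟨0, by simp [IRWState.enter]⟩
  test h := by
    have h' : v.1.length ≠ n := h
    have h2 := v.2
    have := hK v.level (by unfold Node.level; omega) (by unfold Node.level; omega)
    simp only [IRWState.enter]
    omega

/-- On a leaf the sum moves by `± logOdds` and a negative value ends the visit, so it stays a
natural multiple of `logOdds`. -/
lemma IRWState.Reachable.update (hK : ∀ l, 1 ≤ l → l ≤ n → 0 < K l)
    (h0 : Informative μ 0) (hs : s.Reachable μ K) (y : Bool) :
    (irwUpdate μ K tie s y).Reachable μ K := by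
  unfold irwUpdate
  split_ifs with h1 h2 h2 h3
  · exact reachable_enter hK _
  · refine ⟨fun _ => ?_, fun h => absurd h1 h⟩
    obtain ⟨j, hj⟩ := hs.leaf h1
    have hpos := h0.logOdds_pos
    cases y with
    | true => exact ⟨j + 1, by simp only [hj, logLR_true]; push_cast; ring⟩
    | false =>
      rw [hj, logLR_false] at h2
      cases j with
      | zero => simp at h2; linarith
      | succ j => exact ⟨j, by simp only [hj, logLR_false]; push_cast; ring⟩
  · exact ⟨fun h => absurd h h1, fun _ => by simp only; omega⟩
  · exact ⟨fun h => absurd h h1, fun _ => h3⟩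
  · exact reachable_enter hK _

lemma reachable_foldl (hK : ∀ l, 1 ≤ l → l ≤ n → 0 < K l) (h0 : Informative μ 0)
    (obs : List Bool) (hs : s.Reachable μ K) :
    (obs.foldl (irwUpdate μ K tie) s).Reachable μ K := by
  induction obs generalizing s with
  | nil => exact hs
  | cons y obs ih => exact ih (hs.update hK h0 y)

/-- At `k = K v.level` no sample of the left child remains and both branches of the definition
agree, so the boundary case may be read either way. -/
lemma testPotential_of_le {v : Node n} {k : ℕ} (hk : k ≤ K v.level) (x y : ℝ) :
    testPotential μ K tie c β m ⟨v, k, x, y⟩ =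
      ENNReal.ofReal c * ((2 * K v.level - k : ℕ) : ℝ≥0∞) +
        sumExp (obsLaw μ m (v.child true)) (logLR μ (v.level - 1)) (K v.level - k)
          (fun x => sumExp (obsLaw μ m (v.child false)) (logLR μ (v.level - 1)) (K v.level)
            (fun y => entryPotential μ c β m (localTestMove tie v x y)) y) x := by
  rcases hk.lt_or_eq with hk | hk
  · rw [testPotential, if_pos hk]
  · rw [testPotential, if_neg hk.not_lt]
    dsimp only
    rw [hk, Nat.sub_self, sumExp_zero, two_mul, Nat.add_sub_cancel]

lemma testPotential_of_ge {v : Node n} {k : ℕ} (hk : K v.level ≤ k) (x y : ℝ) :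
    testPotential μ K tie c β m ⟨v, k, x, y⟩ =
      ENNReal.ofReal c * ((2 * K v.level - k : ℕ) : ℝ≥0∞) +
        sumExp (obsLaw μ m (v.child false)) (logLR μ (v.level - 1)) (2 * K v.level - k)
          (fun y => entryPotential μ c β m (localTestMove tie v x y)) y := by
  rw [testPotential, if_neg hk.not_gt]

/-- Conditions on the price `β` of a step away from the target. -/
structure IsPrice (μ : ℕ → unitInterval) (n : ℕ) (K : ℕ → ℕ) (p c β : ℝ) : Prop where
  informative : Informative μ 0
  cost_pos : 0 < c
  cost_lt : c < 1
  depth : 1 ≤ n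
  conf : 0 ≤ p
  meets : ∀ l, 1 ≤ l → l ≤ n → MeetsConfidence μ p l (K l)
  nonneg : 0 ≤ β
  other : otherPotential μ n c 0 ≤ β
  test : ∀ l, 1 ≤ l → l ≤ n → c * (2 * K l) + β ≤ 2 * β * p

/-! ### Supermartingale inequalities for the walk -/

namespace IsPrice

/-- Without samples both sums vanish and the strict inequality in `confPresent` fails. Sample size 0
must be excluded because `irwAct` would still take one sample, for which the potential has no
budget. -/
lemma sampleSize_pos (hβ : IsPrice μ n K p c β) (l : ℕ) (hl : 1 ≤ l) (hl' : l ≤ n) : 0 < K l := by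
  rw [Nat.pos_iff_ne_zero]
  intro h
  have h1 := (hβ.meets l hl hl').1
  have h2 := hβ.conf
  rw [h] at h1
  simp [confPresent] at h1
  linarith

lemma threshold_pos (hβ : IsPrice μ n K p c β) : 0 < Real.log (n / c) := by
  apply Real.log_pos
  rw [one_lt_div hβ.cost_pos]
  exact hβ.cost_lt.trans_le (by exact_mod_cast hβ.depth)

lemma drift_pos (hβ : IsPrice μ n K p c β) : 0 < (1 - 2 * (μ 0 : ℝ)) * logOdds μ 0 :=
  mul_pos (by linarith [hβ.informative.2]) hβ.informative.logOdds_pos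

lemma one_lt_exp (hβ : IsPrice μ n K p c β) : 1 < Real.exp (logOdds μ 0) :=
  Real.one_lt_exp_iff.2 hβ.informative.logOdds_pos

/-- The sum overshoots the threshold by at most one increment; the extra `logOdds` in the linear
term is there for this. -/
lemma targetPotential_nonneg (hβ : IsPrice μ n K p c β)
    {x : ℝ} (hx : x ≤ Real.log (n / c) + logOdds μ 0) :
    0 ≤ targetPotential μ n c β x := by
  have h1 := hβ.drift_pos
  have h2 := hβ.one_lt_exp
  have h3 := hβ.cost_pos
  have h4 := hβ.nonneg
  have h5 : 0 < Real.exp (logOdds μ 0) - 1 := by linarith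
  have h6 : 0 ≤ Real.log (n / c) + logOdds μ 0 - x := by linarith
  unfold targetPotential
  positivity

lemma otherPotential_nonneg (hβ : IsPrice μ n K p c β)
    {x : ℝ} (hx : -logOdds μ 0 ≤ x) : 0 ≤ otherPotential μ n c x := by
  have h1 := hβ.drift_pos
  have h3 := hβ.cost_pos
  have h6 : 0 ≤ x + logOdds μ 0 := by linarith
  unfold otherPotential
  positivity

/-- The sum has drift `(1 - 2 μ 0) * logOdds μ 0` on the target, so the linear term loses exactly
`c`; `exp (-x)` is an inverse likelihood ratio, a martingale under the present law. -/
lemma target_step (hβ : IsPrice μ n K p c β) (x : ℝ) :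
    c + targetPotential μ n c β (x + logOdds μ 0) * (1 - μ 0) +
      targetPotential μ n c β (x + -logOdds μ 0) * μ 0 = targetPotential μ n c β x := by
  have h1 := hβ.drift_pos.ne'
  have e1 := hβ.informative.mul_exp_logOdds
  have e2 := hβ.informative.mul_exp_neg_logOdds
  unfold targetPotential
  simp only [neg_add, neg_neg, Real.exp_add]
  generalize β / (Real.exp (logOdds μ 0) - 1) = b
  generalize Real.exp (-x) = y at *
  generalize Real.exp (logOdds μ 0) = e at *
  generalize Real.exp (-logOdds μ 0) = e' at *
  generalize Real.log (n / c) = a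
  have key : b * (y * e') * (1 - μ 0) + b * (y * e) * μ 0 = b * y := by
    linear_combination b * y * e1 + b * y * e2
  have key2 : c + c * (a + logOdds μ 0 - (x + logOdds μ 0)) /
      ((1 - 2 * μ 0) * logOdds μ 0) * (1 - μ 0) +
      c * (a + logOdds μ 0 - (x + -logOdds μ 0)) / ((1 - 2 * μ 0) * logOdds μ 0) * μ 0 =
      c * (a + logOdds μ 0 - x) / ((1 - 2 * μ 0) * logOdds μ 0) := by
    have h2 := left_ne_zero_of_mul h1
    have h3 := right_ne_zero_of_mul h1
    field_simp
    ring
  linear_combination key + key2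

/-- Mirror image of `target_step`: the drift changes sign, and the likelihood ratio `exp x` is a
martingale under the absent law. -/
lemma other_step (hβ : IsPrice μ n K p c β) (x : ℝ) :
    c + otherPotential μ n c (x + logOdds μ 0) * μ 0 +
      otherPotential μ n c (x + -logOdds μ 0) * (1 - μ 0) = otherPotential μ n c x := by
  have h1 := hβ.drift_pos.ne'
  have e1 := hβ.informative.mul_exp_logOdds
  have e2 := hβ.informative.mul_exp_neg_logOdds
  unfold otherPotential
  simp only [sub_eq_add_neg, Real.exp_add]
  generalize Real.exp (-Real.log (n / c)) = b
  generalize Real.exp x = y at *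
  generalize Real.exp (logOdds μ 0) = e at *
  generalize Real.exp (-logOdds μ 0) = e' at *
  have key : y * e' * b * (1 - μ 0) + y * e * b * μ 0 = y * b := by
    linear_combination b * y * e1 + b * y * e2
  have key2 : c + c * (x + logOdds μ 0 + logOdds μ 0) /
      ((1 - 2 * μ 0) * logOdds μ 0) * μ 0 +
      c * (x + -logOdds μ 0 + logOdds μ 0) / ((1 - 2 * μ 0) * logOdds μ 0) * (1 - μ 0) =
      c * (x + logOdds μ 0) / ((1 - 2 * μ 0) * logOdds μ 0) := by
    have h2 := left_ne_zero_of_mul h1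
    have h3 := right_ne_zero_of_mul h1
    field_simp
    ring
  simp only [sub_eq_add_neg] at key key2
  linear_combination key + key2

/-- Leaving the target leaf is paid for by the potential one step below zero. -/
lemma price_add_le_targetPotential (hβ : IsPrice μ n K p c β) :
    β + targetPotential μ n c β 0 ≤ targetPotential μ n c β (-logOdds μ 0) := by
  have h1 := hβ.drift_pos
  have h2 : Real.exp (logOdds μ 0) - 1 ≠ 0 := by linarith [hβ.one_lt_exp]
  have h3 := hβ.cost_pos
  have h4 := hβ.informative.logOdds_pos
  -- The coefficient of the exponential term is chosen so that this term grows by exactly `β` from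
  -- `x = 0` to `x = -logOdds μ 0`.
  have key : β / (Real.exp (logOdds μ 0) - 1) * Real.exp (logOdds μ 0) =
      β / (Real.exp (logOdds μ 0) - 1) + β := by
    field_simp
    ring
  unfold targetPotential
  rw [neg_neg, key, neg_zero, Real.exp_zero, mul_one]
  have : c * (Real.log (n / c) + logOdds μ 0 - 0) / ((1 - 2 * μ 0) * logOdds μ 0) ≤
      c * (Real.log (n / c) + logOdds μ 0 - -logOdds μ 0) / ((1 - 2 * μ 0) * logOdds μ 0) := by
    gcongr
    linarith
  linarith

/-- On the target leaf this is immediate. A wrong leaf is one step farther than its parent, and that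
step's price covers the excess potential. On an inner node it is the drift of the local test. -/
lemma statePotential_enter_le (hβ : IsPrice μ n K p c β) (v : Node n) :
    statePotential μ K tie c β m (IRWState.enter v) ≤ entryPotential μ c β m v := by
  have hγ : 0 ≤ targetPotential μ n c β 0 :=
    hβ.targetPotential_nonneg (by linarith [hβ.threshold_pos, hβ.informative.logOdds_pos])
  have hb := hβ.nonneg
  unfold statePotential IRWState.enter
  dsimp only
  split_ifs with h
  · unfold leafPotential
    dsimp only
    split_ifs with hm
    · exact ENNReal.ofReal_le_ofReal (le_add_of_nonneg_left (by positivity))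
    · have ho := hβ.other
      have hd := Node.parent_dist_of_not_contains hm
      unfold entryPotential
      rw [← hd, ← ENNReal.ofReal_add (by positivity) (hβ.otherPotential_nonneg
        (by linarith [hβ.informative.logOdds_pos]))]
      refine ENNReal.ofReal_le_ofReal ?_
      push_cast
      linarith
  · have hv : v.1.length < n := lt_of_le_of_ne v.2 h
    have hl : 1 ≤ v.level := by unfold Node.level; omega
    have hl' : v.level ≤ n := by unfold Node.level; omega
    have hK := hβ.sampleSize_pos _ hl hl'
    have hc := hβ.cost_pos
    have hdrift := local_test_drift (m := m) tie hv (hβ.meets _ hl hl') hb hγ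
      (t := c * (2 * K v.level)) (by positivity) (hβ.test _ hl hl')
    unfold testPotential
    dsimp only
    rw [if_pos hK, Nat.sub_zero, Nat.sub_zero]
    refine le_trans (le_of_eq ?_) hdrift
    rw [ENNReal.ofReal_mul hc.le]
    congr 2
    rw [← ENNReal.ofReal_natCast]
    push_cast
    rfl

/-- Every sample but the last gives equality: its cost leaves the budget and `sumExp_succ` handles
the mean. Only the last sample, which opens a new visit, needs an inequality. -/
lemma testPotential_step (hβ : IsPrice μ n K p c β)
    (hs : s.Reachable μ K) (h : s.node.1.length ≠ n) (b : Bool)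
    (hb : b = decide (s.count < K s.node.level)) :
    ENNReal.ofReal c + ∫⁻ o, statePotential μ K tie c β m (irwUpdate μ K tie s o)
      ∂obsLaw μ m (s.node.child b) ≤ statePotential μ K tie c β m s := by
  obtain ⟨v, k, x, y⟩ := s
  have hk := hs.test h
  dsimp only at h hb hk ⊢
  have hcost : ∀ j, ENNReal.ofReal c * ((j + 1 : ℕ) : ℝ≥0∞) =
      ENNReal.ofReal c + ENNReal.ofReal c * (j : ℝ≥0∞) := fun j => by
    push_cast; ring
  conv_rhs => rw [statePotential, if_neg h]
  by_cases hkN : k < K v.level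
  · rw [decide_eq_true hkN] at hb
    subst hb
    have hu : ∀ o, statePotential μ K tie c β m (irwUpdate μ K tie ⟨v, k, x, y⟩ o) = _ :=
      fun o => by
        rw [irwUpdate, if_neg h, if_pos hkN, statePotential, if_neg h,
          testPotential_of_le (Nat.succ_le_of_lt hkN)]
    simp only [hu]
    rw [testPotential_of_le hkN.le, lintegral_add_left measurable_const, lintegral_const,
      measure_univ, mul_one, show K v.level - k = (K v.level - (k + 1)) + 1 by omega, sumExp_succ,
      show 2 * K v.level - k = (2 * K v.level - (k + 1)) + 1 by omega, hcost, add_assoc]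
  · rw [decide_eq_false hkN] at hb
    subst hb
    have hge : K v.level ≤ k := not_lt.1 hkN
    by_cases hk2 : k + 1 < 2 * K v.level
    · have hu : ∀ o, statePotential μ K tie c β m (irwUpdate μ K tie ⟨v, k, x, y⟩ o) = _ :=
        fun o => by
          rw [irwUpdate, if_neg h, if_neg hkN, if_pos hk2, statePotential, if_neg h,
            testPotential_of_ge (hge.trans (Nat.le_succ k))]
      simp only [hu]
      rw [testPotential_of_ge hge, lintegral_add_left measurable_const, lintegral_const,
        measure_univ, mul_one, show 2 * K v.level - k = (2 * K v.level - (k + 1)) + 1 by omega,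
        sumExp_succ, hcost, add_assoc]
    · have hu : ∀ o, statePotential μ K tie c β m (irwUpdate μ K tie ⟨v, k, x, y⟩ o) ≤
          entryPotential μ c β m (localTestMove tie v x (y + logLR μ (v.level - 1) o)) :=
        fun o => by
          rw [irwUpdate, if_neg h, if_neg hkN, if_neg hk2]
          exact hβ.statePotential_enter_le _
      rw [testPotential_of_ge hge, show 2 * K v.level - k = 0 + 1 by omega, sumExp_succ, hcost]
      simp only [sumExp_zero, Nat.cast_zero, mul_zero, add_zero]
      gcongr
      exact hu _

lemma leafPotential_step (hβ : IsPrice μ n K p c β) (hs : s.Reachable μ K) (h : s.node.1.length = n)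
    (hx : s.sumL ≤ Real.log (n / c)) :
    ENNReal.ofReal c + ∫⁻ o, statePotential μ K tie c β m (irwUpdate μ K tie s o)
      ∂obsLaw μ m s.node ≤ statePotential μ K tie c β m s := by
  obtain ⟨v, k, x, y⟩ := s
  obtain ⟨j, hj⟩ := hs.leaf h
  dsimp only at h hx hj ⊢
  have hpos := hβ.informative.logOdds_pos
  have hq := hβ.informative.1
  have hq' : 0 < 1 - (μ 0 : ℝ) := by linarith [hβ.informative.2]
  have hc := hβ.cost_pos
  have hb := hβ.nonneg
  have hlev : v.level = 0 := by rw [Node.level, h, Nat.sub_self]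
  have hxnn : 0 ≤ x := by rw [hj]; positivity
  have hup : irwUpdate μ K tie ⟨v, k, x, y⟩ true = ⟨v, k + 1, x + logOdds μ 0, 0⟩ := by
    rw [irwUpdate, if_pos h, if_neg (by dsimp only; rw [logLR_true]; linarith), logLR_true]
  have hdown : irwUpdate μ K tie ⟨v, k, x, y⟩ false =
      if x + -logOdds μ 0 < 0 then IRWState.enter v.parent
      else ⟨v, k + 1, x + -logOdds μ 0, 0⟩ := by
    rw [irwUpdate, if_pos h]
    dsimp only
    rw [logLR_false]
  -- On the lattice of multiples of `logOdds μ 0`, a visit can end only by a step down from 0.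
  have hzero : x + -logOdds μ 0 < 0 → x + -logOdds μ 0 = -logOdds μ 0 := fun hlt => by
    cases j with
    | zero => simp [hj]
    | succ j =>
      have : (0 : ℝ) ≤ j * logOdds μ 0 := by positivity
      rw [hj] at hlt
      push_cast at hlt
      linarith
  by_cases hm : v.Contains m
  · rw [obsLaw_of_contains μ hm, hlev, lintegral_presentLaw, hup, hdown]
    have h1 : ∀ k x y, statePotential μ K tie c β m ⟨v, k, x, y⟩ =
        ENNReal.ofReal (targetPotential μ n c β x) := fun k x y => by
      rw [statePotential, if_pos h, leafPotential, if_pos hm]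
    have h2 : statePotential μ K tie c β m (if x + -logOdds μ 0 < 0 then
        IRWState.enter v.parent else ⟨v, k + 1, x + -logOdds μ 0, 0⟩) ≤
        ENNReal.ofReal (targetPotential μ n c β (x + -logOdds μ 0)) := by
      split_ifs with hlt
      · refine (hβ.statePotential_enter_le _).trans (ENNReal.ofReal_le_ofReal ?_)
        rw [hzero hlt]
        refine le_trans ?_ hβ.price_add_le_targetPotential
        have hd : (v.parent.dist m : ℝ) ≤ 1 := by
          have := v.parent_dist_le m
          rw [Node.dist_of_contains hm, h, Nat.sub_self] at this
          exact_mod_cast this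
        nlinarith
      · exact (h1 _ _ _).le
    have hg1 := hβ.targetPotential_nonneg (x := x + logOdds μ 0) (by linarith)
    have hg2 := hβ.targetPotential_nonneg (x := x + -logOdds μ 0) (by linarith)
    refine (add_le_add_right (add_le_add_right (mul_le_mul_left h2 _) _) _).trans (le_of_eq ?_)
    rw [h1, h1, ← ENNReal.ofReal_mul hg1, ← ENNReal.ofReal_mul hg2,
      ← ENNReal.ofReal_add (by positivity) (by positivity),
      ← ENNReal.ofReal_add hc.le (by positivity),
      ← add_assoc, hβ.target_step]
  · rw [obsLaw_of_not_contains μ hm, hlev, lintegral_absentLaw, hup, hdown]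
    set U := entryPotential μ c β m v.parent with hU
    have h1 : ∀ k x y, statePotential μ K tie c β m ⟨v, k, x, y⟩ =
        U + ENNReal.ofReal (otherPotential μ n c x) := fun k x y => by
      rw [statePotential, if_pos h, leafPotential, if_neg hm]
    have h2 : statePotential μ K tie c β m (if x + -logOdds μ 0 < 0 then
        IRWState.enter v.parent else ⟨v, k + 1, x + -logOdds μ 0, 0⟩) ≤
        U + ENNReal.ofReal (otherPotential μ n c (x + -logOdds μ 0)) := by
      split_ifs with hlt
      · exact (hβ.statePotential_enter_le _).trans le_self_add
      · exact (h1 _ _ _).le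
    have hg1 := hβ.otherPotential_nonneg (x := x + logOdds μ 0) (by linarith)
    have hg2 := hβ.otherPotential_nonneg (x := x + -logOdds μ 0) (by linarith)
    refine (add_le_add_right (add_le_add_right (mul_le_mul_left h2 _) _) _).trans (le_of_eq ?_)
    have hone : ENNReal.ofReal (μ 0) + ENNReal.ofReal (1 - μ 0) = 1 := by
      rw [← ENNReal.ofReal_add hq.le hq'.le]; simp
    rw [h1, h1, ← hβ.other_step x, ENNReal.ofReal_add (by positivity) (by positivity),
      ENNReal.ofReal_add (by positivity) (by positivity), ENNReal.ofReal_mul hg1,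
      ENNReal.ofReal_mul hg2]
    conv_rhs => rw [← mul_one U, ← hone]
    ring

/-- The potential of the walk, as a function of the observations, bounds the loss to come. -/
lemma isPotential (hβ : IsPrice μ n K p c β) (tie : Node n → Bool) (m : Leaf n) :
    (irw n μ K tie c).IsPotential μ m (ENNReal.ofReal c) fun obs =>
      statePotential μ K tie c β m
        (obs.foldl (irwUpdate μ K tie) (IRWState.enter Node.root)) where
  step obs v hv := by
    have hs := reachable_foldl (tie := tie) hβ.sampleSize_pos hβ.informative obs
      (reachable_enter hβ.sampleSize_pos Node.root)
    simp only [List.foldl_append, List.foldl_cons, List.foldl_nil]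
    rw [irw] at hv
    generalize obs.foldl (irwUpdate μ K tie) (IRWState.enter Node.root) = s at hs hv ⊢
    unfold irwAct at hv
    split_ifs at hv with h1 h2 h2
    · obtain rfl := Sum.inl.inj hv
      exact hβ.leafPotential_step hs h1 (not_lt.1 h2)
    · obtain rfl := Sum.inl.inj hv
      exact hβ.testPotential_step hs h1 true (decide_eq_true h2).symm
    · obtain rfl := Sum.inl.inj hv
      exact hβ.testPotential_step hs h1 false (decide_eq_false h2).symm
  wrong obs m' hm' hne := by
    rw [irw] at hm'
    generalize obs.foldl (irwUpdate μ K tie) (IRWState.enter Node.root) = s at hm' ⊢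
    unfold irwAct at hm'
    split_ifs at hm' with h1 h2 h2
    have hm := Sum.inr.inj hm'
    have hnot : ¬ s.node.Contains m := fun h => by
      refine hne (hm.symm.trans (Subtype.ext ?_))
      exact List.IsSuffix.eq_of_length h (h1.trans m.2.symm)
    rw [statePotential, if_pos h1, leafPotential, if_neg hnot]
    refine le_add_left (ENNReal.one_le_ofReal.2 ?_)
    have ha := hβ.threshold_pos
    have hl := hβ.informative.logOdds_pos
    have hd := hβ.drift_pos
    have hc := hβ.cost_pos
    have h3 : 0 ≤ s.sumL + logOdds μ 0 := by linarith
    -- Above the threshold the likelihood-ratio term alone covers the loss of a wrong declaration.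
    have h4 : 1 ≤ Real.exp (s.sumL - Real.log (n / c)) := Real.one_le_exp (by linarith)
    exact h4.trans (le_add_of_nonneg_left (by positivity))

/-- Bayes risk of the walk in terms of the price. -/
theorem bayesRisk_le (hβ : IsPrice μ n K p c β) (tie : Node n → Bool) (π : PMF (Leaf n)) :
    (irw n μ K tie c).bayesRisk μ π c ≤
      ENNReal.ofReal (β * n + targetPotential μ n c β 0) := by
  have hrisk : ∀ m : Leaf n, _ ≤ ENNReal.ofReal (β * n + targetPotential μ n c β 0) := fun m =>
    ((hβ.isPotential tie m).risk_le (by simpa using hβ.cost_pos) ENNReal.ofReal_ne_top).trans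
      (by simpa [entryPotential, Node.root_dist] using
        hβ.statePotential_enter_le (tie := tie) (m := m) Node.root)
  have hπ : ∑ m, π m = 1 := by rw [← tsum_fintype (L := .unconditional _)]; exact π.tsum_coe
  rw [Strategy.bayesRisk, Strategy.errorProb, Strategy.sampleComplexity, Finset.mul_sum,
    ← Finset.sum_add_distrib]
  calc _ = ∑ m, π m * (hypMeasure μ m {ω | ¬ (irw n μ K tie c).Declares m ω} +
        ENNReal.ofReal c * ∫⁻ ω, (irw n μ K tie c).stopTime ω ∂hypMeasure μ m) :=
        Finset.sum_congr rfl fun m _ => by ring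
    _ ≤ ∑ m, π m * ENNReal.ofReal (β * n + targetPotential μ n c β 0) :=
        Finset.sum_le_sum fun m _ => by gcongr; exact hrisk m
    _ = _ := by rw [← Finset.sum_mul, hπ, one_mul]

end IsPrice

end Potential

/-! ### Polynomial decay: sample sizes and the risk -/

variable {α : ℕ} {μ₀ p η : ℝ} {A n : ℕ} {K : ℕ → ℕ}

/-- Factor in front of `l ^ (2 α)` in the bound on the closed-form sample size. -/
def sizeFactor (μ₀ η : ℝ) : ℝ := 12 * Real.log (1 / (1 - η)) / (1 - 2 * μ₀) ^ 2 + 1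

lemma sizeFactor_nonneg (hη : 0 < η) (hη' : η < 1) : 0 ≤ sizeFactor μ₀ η := by
  have hL : 0 < Real.log (1 / (1 - η)) :=
    Real.log_pos ((one_lt_div (by linarith)).2 (by linarith))
  unfold sizeFactor
  positivity

lemma IsSampleRule.le_mul_pow (hμ₀ : 0 < μ₀) (hμ₀' : μ₀ < 1 / 2) (hp : 0 < p) (hp' : p < 1)
    (hη : 0 < η) (hη' : η < 1) (hK : IsSampleRule (polyNoise α μ₀) p η A n K) {l : ℕ}
    (hl : 1 ≤ l) (hln : l ≤ n) :
    (K l : ℝ) ≤ A * (sizeFactor μ₀ (Real.sqrt p) + sizeFactor μ₀ η) * (n : ℝ) ^ (2 * α) := by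
  have hs : 0 < Real.sqrt p := Real.sqrt_pos.2 hp
  have hs' : Real.sqrt p < 1 := (Real.sqrt_lt' one_pos).2 (by linarith)
  have h1 : (minSampleSize (polyNoise α μ₀) p l : ℝ) ≤
      sizeFactor μ₀ (Real.sqrt p) * (l : ℝ) ^ (2 * α) :=
    le_trans
      (Nat.cast_le.2 ((informative_polyNoise α hμ₀ hμ₀' (l - 1)).minSampleSize_spec hp hp').2)
      (explicitSampleSize_polyNoise_le α hμ₀ hμ₀' hs hs' hl)
  have h2 : (explicitSampleSize (polyNoise α μ₀) η l : ℝ) ≤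
      sizeFactor μ₀ η * (l : ℝ) ^ (2 * α) :=
    explicitSampleSize_polyNoise_le α hμ₀ hμ₀' hη hη' hl
  have hf1 := sizeFactor_nonneg (μ₀ := μ₀) hs hs'
  have hf2 := sizeFactor_nonneg (μ₀ := μ₀) hη hη'
  have h3 : (K l : ℝ) ≤ A * max (minSampleSize (polyNoise α μ₀) p l : ℝ)
      (explicitSampleSize (polyNoise α μ₀) η l) := by
    exact_mod_cast (hK l hl hln).2
  have h4 : (l : ℝ) ^ (2 * α) ≤ (n : ℝ) ^ (2 * α) := by gcongr
  refine h3.trans ?_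
  rw [mul_assoc]
  gcongr
  calc _ ≤ (sizeFactor μ₀ (Real.sqrt p) + sizeFactor μ₀ η) * (l : ℝ) ^ (2 * α) := by
        have : 0 ≤ (l : ℝ) ^ (2 * α) := by positivity
        exact max_le (h1.trans (by nlinarith)) (h2.trans (by nlinarith))
    _ ≤ _ := by gcongr

/-- The price of a step away from the target, relative to `c (log₂ M) ^ (2 α)`. -/
def priceFactor (α : ℕ) (μ₀ p η : ℝ) (A : ℕ) : ℝ :=
  (2 * (A * (sizeFactor μ₀ (Real.sqrt p) + sizeFactor μ₀ η)) +
    (1 - 2 * (polyNoise α μ₀ 0 : ℝ))⁻¹ + 1) / (2 * p - 1)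

/-- The numerator of `priceFactor` has one part for the `2 K_l` samples of a test and one for a
visit to a wrong leaf, whose excess potential is `c / (1 - 2 μ 0) + c / n`. The denominator `2 * p -
1` is the drift. -/
lemma IsSampleRule.isPrice (hμ₀ : 0 < μ₀) (hμ₀' : μ₀ < 1 / 2) (hp : 1 / 2 < p) (hp' : p < 1)
    (hη : 0 < η) (hη' : η < 1) (hK : IsSampleRule (polyNoise α μ₀) p η A n K) (hn : 1 ≤ n)
    {c : ℝ} (hc : 0 < c) (hc' : c < 1) :
    IsPrice (polyNoise α μ₀) n K p c (c * (priceFactor α μ₀ p η A * (n : ℝ) ^ (2 * α))) := by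
  have h0 := informative_polyNoise α hμ₀ hμ₀' 0
  have hn' : (1 : ℝ) ≤ n := by exact_mod_cast hn
  have hpow : (1 : ℝ) ≤ (n : ℝ) ^ (2 * α) := one_le_pow₀ hn'
  have hp2 : 0 < 2 * p - 1 := by linarith
  have hq : 0 < 1 - 2 * (polyNoise α μ₀ 0 : ℝ) := by linarith [h0.2]
  have hF : 0 ≤ A * (sizeFactor μ₀ (Real.sqrt p) + sizeFactor μ₀ η) := by
    have hf1 := sizeFactor_nonneg (μ₀ := μ₀) (Real.sqrt_pos.2 (by linarith : 0 < p))
      ((Real.sqrt_lt' one_pos).2 (by linarith))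
    have hf2 := sizeFactor_nonneg (μ₀ := μ₀) hη hη'
    positivity
  have hmul : priceFactor α μ₀ p η A * (2 * p - 1) =
      2 * (A * (sizeFactor μ₀ (Real.sqrt p) + sizeFactor μ₀ η)) +
        (1 - 2 * (polyNoise α μ₀ 0 : ℝ))⁻¹ + 1 := div_mul_cancel₀ _ hp2.ne'
  have hfac : 0 ≤ priceFactor α μ₀ p η A := by unfold priceFactor; positivity
  have hi : 0 < (1 - 2 * (polyNoise α μ₀ 0 : ℝ))⁻¹ := inv_pos.2 hq
  refine ⟨h0, hc, hc', hn, by linarith, fun l hl hln => (hK l hl hln).1, by positivity, ?_, ?_⟩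
  · have h1 : otherPotential (polyNoise α μ₀) n c 0 =
        c * (1 - 2 * (polyNoise α μ₀ 0 : ℝ))⁻¹ + c / n := by
      have := h0.logOdds_pos.ne'
      rw [otherPotential, zero_sub, ← Real.log_inv, inv_div, Real.exp_log (by positivity), zero_add]
      field_simp
    have h2 : c / n ≤ c := div_le_self hc.le hn'
    -- As `2 * p - 1 < 1`, the division in `priceFactor` only enlarges it.
    have h3 : (1 - 2 * (polyNoise α μ₀ 0 : ℝ))⁻¹ + 1 ≤ priceFactor α μ₀ p η A := by nlinarith
    rw [h1]
    calc _ ≤ c * ((1 - 2 * (polyNoise α μ₀ 0 : ℝ))⁻¹ + 1) := by linarith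
      _ ≤ _ := by
        gcongr
        exact h3.trans (le_mul_of_one_le_right hfac hpow)
  · intro l hl hln
    have h1 := hK.le_mul_pow hμ₀ hμ₀' (by linarith) hp' hη hη' hl hln
    have h2 : 2 * (K l : ℝ) ≤
        priceFactor α μ₀ p η A * (2 * p - 1) * (n : ℝ) ^ (2 * α) := by
      rw [hmul]
      nlinarith
    have h3 := mul_le_mul_of_nonneg_left h2 hc.le
    linarith

lemma IsSampleRule.bayesRisk_le (hμ₀ : 0 < μ₀) (hμ₀' : μ₀ < 1 / 2) (hp : 1 / 2 < p) (hp' : p < 1)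
    (hη : 0 < η) (hη' : η < 1) (hK : IsSampleRule (polyNoise α μ₀) p η A n K) (hn : 1 ≤ n)
    {c : ℝ} (hc : 0 < c) (hc' : c < 1) (tie : Node n → Bool) (π : PMF (Leaf n)) :
    (irw n (polyNoise α μ₀) K tie c).bayesRisk (polyNoise α μ₀) π c ≤
      ENNReal.ofReal
        (priceFactor α μ₀ p η A * (1 + (Real.exp (logOdds (polyNoise α μ₀) 0) - 1)⁻¹) *
            (c * (n : ℝ) ^ (2 * α + 1)) +
          c * Real.log ((n : ℝ) / c) /
            (InformationTheory.klDiv (presentLaw (polyNoise α μ₀) 0)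
              (absentLaw (polyNoise α μ₀) 0)).toReal +
          (1 - 2 * (polyNoise α μ₀ 0 : ℝ))⁻¹ * c) := by
  have hβ := hK.isPrice hμ₀ hμ₀' hp hp' hη hη' hn hc hc'
  refine (hβ.bayesRisk_le tie π).trans (ENNReal.ofReal_le_ofReal ?_)
  have h0 := hβ.informative
  rw [h0.klDiv_toReal, targetPotential, neg_zero, Real.exp_zero, mul_one, sub_zero]
  have hn' : (1 : ℝ) ≤ n := by exact_mod_cast hn
  have hl := h0.logOdds_pos
  have hq : 0 < 1 - 2 * (polyNoise α μ₀ 0 : ℝ) := by linarith [h0.2]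
  have he : 0 < Real.exp (logOdds (polyNoise α μ₀) 0) - 1 := by linarith [hβ.one_lt_exp]
  have hb := hβ.nonneg
  have hsplit : c * (Real.log (n / c) + logOdds (polyNoise α μ₀) 0) /
      ((1 - 2 * (polyNoise α μ₀ 0 : ℝ)) * logOdds (polyNoise α μ₀) 0) =
      c * Real.log (n / c) / ((1 - 2 * (polyNoise α μ₀ 0 : ℝ)) * logOdds (polyNoise α μ₀) 0) +
        (1 - 2 * (polyNoise α μ₀ 0 : ℝ))⁻¹ * c := by
    field_simp
  -- The exponential term at the start is of order `c n ^ (2 α)` and is absorbed into the leading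
  -- term by `n ≥ 1`.
  have hlast : c * (priceFactor α μ₀ p η A * (n : ℝ) ^ (2 * α)) /
      (Real.exp (logOdds (polyNoise α μ₀) 0) - 1) ≤
      c * (priceFactor α μ₀ p η A * (n : ℝ) ^ (2 * α)) * n *
        (Real.exp (logOdds (polyNoise α μ₀) 0) - 1)⁻¹ := by
    rw [div_eq_mul_inv]
    exact mul_le_mul_of_nonneg_right (le_mul_of_one_le_right hb hn') (inv_pos.2 he).le
  rw [hsplit, pow_succ]
  linarith

/-- A bound on the Bayes risk bounds the sample complexity. -/
lemma sampleComplexity_le_of_bayesRisk_le {Γ : Strategy n} {μ : ℕ → unitInterval}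
    {π : PMF (Leaf n)} {c x : ℝ} (hc : 0 < c)
    (h : Γ.bayesRisk μ π c ≤ ENNReal.ofReal (c * x)) :
    Γ.sampleComplexity μ π ≤ ENNReal.ofReal x := by
  have h1 : ENNReal.ofReal c * Γ.sampleComplexity μ π ≤ ENNReal.ofReal c * ENNReal.ofReal x := by
    rw [← ENNReal.ofReal_mul hc.le]
    exact le_add_self.trans h
  exact (ENNReal.mul_le_mul_iff_right (by simpa using hc) ENNReal.ofReal_ne_top).1 h1

end TreeSearch

end

/-! ### Confidence levels, Bayes risk and sample complexity -/

theorem theorem2 (α : ℕ) (hα : 1 ≤ α) (μ₀ : ℝ) (hμ₀ : 0 < μ₀) (hμ₀' : μ₀ < 1 / 2) :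
    -- the least and the closed-form sample sizes have the confidence levels `p` and `η ^ 2`
    (∀ p : ℝ, 1 / 2 < p → p < 1 → ∀ l : ℕ, 1 ≤ l →
      MeetsConfidence (polyNoise α μ₀) p l (minSampleSize (polyNoise α μ₀) p l)) ∧
    (∀ η : ℝ, 1 / Real.sqrt 2 < η → η < 1 → ∀ l : ℕ, 1 ≤ l →
      MeetsConfidence (polyNoise α μ₀) (η ^ 2) l (explicitSampleSize (polyNoise α μ₀) η l)) ∧
    ∀ p : ℝ, 1 / 2 < p → p < 1 → ∀ η : ℝ, 1 / Real.sqrt 2 < η → η < 1 → ∀ A : ℕ,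
      -- the Bayes risk; the depth of the tree is `n = log₂ M`
      (∃ B₁ B₂ : ℝ, ∀ n : ℕ, 1 ≤ n → ∀ c : ℝ, 0 < c → c < 1 →
        ∀ (π : PMF (Leaf n)) (tie : Node n → Bool) (K : ℕ → ℕ),
          IsSampleRule (polyNoise α μ₀) p η A n K →
          (irw n (polyNoise α μ₀) K tie c).bayesRisk (polyNoise α μ₀) π c ≤
            ENNReal.ofReal
              (B₁ * (c * (n : ℝ) ^ (2 * α + 1)) +
                c * Real.log ((n : ℝ) / c) /
                  (InformationTheory.klDiv (presentLaw (polyNoise α μ₀) 0)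
                    (absentLaw (polyNoise α μ₀) 0)).toReal +
                B₂ * c)) ∧
      -- the sample complexity, for a fixed `c`
      (∀ c : ℝ, 0 < c → c < 1 → ∃ C : ℝ, ∀ n : ℕ, 1 ≤ n →
        ∀ (π : PMF (Leaf n)) (tie : Node n → Bool) (K : ℕ → ℕ),
          IsSampleRule (polyNoise α μ₀) p η A n K →
          (irw n (polyNoise α μ₀) K tie c).sampleComplexity (polyNoise α μ₀) π ≤
            ENNReal.ofReal (C * (n : ℝ) ^ (2 * α + 1))) := by
  have hsqrt : 0 < 1 / Real.sqrt 2 := by positivity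
  refine ⟨fun p hp hp' l _ =>
      ((informative_polyNoise α hμ₀ hμ₀' (l - 1)).minSampleSize_spec (by linarith) hp').1,
    fun η hη hη' l _ =>
      (informative_polyNoise α hμ₀ hμ₀' (l - 1)).meetsConfidence_explicitSampleSize
        (hsqrt.trans hη) hη', fun p hp hp' η hη hη' A => ⟨⟨_, _, fun n hn c hc hc' π tie K hK =>
      hK.bayesRisk_le hμ₀ hμ₀' hp hp' (hsqrt.trans hη) hη' hn hc hc' tie π⟩, ?_⟩⟩
  intro c hc hc'
  have h0 := informative_polyNoise α hμ₀ hμ₀' 0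
  have hq : 0 < 1 - 2 * (polyNoise α μ₀ 0 : ℝ) := by linarith [h0.2]
  -- The three terms of the risk bound divided by `c`; the middle one uses `log (n / c) ≤ n / c`,
  -- and each is then compared with `n ^ (2 * α + 1)`.
  refine ⟨priceFactor α μ₀ p η A * (1 + (Real.exp (logOdds (polyNoise α μ₀) 0) - 1)⁻¹) +
    (c * ((1 - 2 * (polyNoise α μ₀ 0 : ℝ)) * logOdds (polyNoise α μ₀) 0))⁻¹ +
    (1 - 2 * (polyNoise α μ₀ 0 : ℝ))⁻¹, fun n hn π tie K hK => ?_⟩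
  refine sampleComplexity_le_of_bayesRisk_le hc
    ((hK.bayesRisk_le hμ₀ hμ₀' hp hp' (hsqrt.trans hη) hη' hn hc hc' tie π).trans
      (ENNReal.ofReal_le_ofReal ?_))
  rw [h0.klDiv_toReal]
  have hn' : (1 : ℝ) ≤ n := by exact_mod_cast hn
  have hpow : (n : ℝ) ≤ (n : ℝ) ^ (2 * α + 1) := le_self_pow₀ hn' (by omega)
  have hD : 0 < (1 - 2 * (polyNoise α μ₀ 0 : ℝ)) * logOdds (polyNoise α μ₀) 0 :=
    mul_pos hq h0.logOdds_pos
  generalize (1 - 2 * (polyNoise α μ₀ 0 : ℝ)) * logOdds (polyNoise α μ₀) 0 = D at hD ⊢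
  have h1 : Real.log (n / c) ≤ (n : ℝ) ^ (2 * α + 1) / c :=
    (Real.log_le_self (by positivity)).trans (by gcongr)
  have h2 : c * Real.log (n / c) / D ≤ c * ((c * D)⁻¹ * (n : ℝ) ^ (2 * α + 1)) := by
    calc _ ≤ c * ((n : ℝ) ^ (2 * α + 1) / c) / D := by gcongr
      _ = _ := by field_simp
  have h3 : (1 - 2 * (polyNoise α μ₀ 0 : ℝ))⁻¹ * c ≤
      c * ((1 - 2 * (polyNoise α μ₀ 0 : ℝ))⁻¹ * (n : ℝ) ^ (2 * α + 1)) := by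
    rw [mul_comm]
    gcongr
    exact le_mul_of_one_le_right (inv_pos.2 hq).le (hn'.trans hpow)
  linarith
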